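/- Let $k$ be a field, let $S=k[x_1,\ldots,x_n]$ with the standard grading $\deg x_i=1$, and let $\mathfrak m=(x_1,\ldots,x_n)$. For a nonzero finitely generated $\mathbb Z$-graded $S$-module $N$ of Krull dimension $r$, let $e(N)$ be the positive integer with \[ \sum_{i\le j}\dim_k N_i=\frac{e(N)}{r!}\,j^{r}+O(j^{r-1})\qquad (j\to+\infty), \] and set $e_r(N)=e(N)$ and $e_s(N)=0$ for $s>r$. Such an $N$ is called Cohen–Macaulay if its depth (the maximal length of an $N$-regular sequence in $\mathfrak m$) equals its Krull dimension. Let $M$ be a finitely generated $\mathbb Z$-graded $S$-module of Krull dimension $d>0$, and let $\ell\in S_1$ be such that $M/\ell M$ is Cohen–Macaulay of dimension $d-1$ and $e_{d-1}(M/\ell M)=e_d(M)$. Then $\ell$ is an $M$-regular element (a nonzerodivisor on $M$), and $M$ is Cohen–Macaulay. -/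

import Mathlib

open MvPolynomial
open scoped Pointwise

/-- `ℳ` is a `ℤ`-grading of the module `M` over the standard graded polynomial ring
`S = k[x₁, …, xₙ]`: `M` is the internal direct sum of the `k`-subspaces `ℳ j`, and
`S_i • ℳ j ⊆ ℳ (i + j)`. -/
structure IsGradedPolyModule {k : Type*} [Field k] {n : ℕ} {M : Type*} [AddCommGroup M]
    [Module k M] [Module (MvPolynomial (Fin n) k) M] (ℳ : ℤ → Submodule k M) : Prop where
  isInternal : DirectSum.IsInternal ℳ
  smul_mem : ∀ (i : ℕ) (j : ℤ) (f : MvPolynomial (Fin n) k) (m : M),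
    f.IsHomogeneous i → m ∈ ℳ j → f • m ∈ ℳ ((i : ℤ) + j)

/-- The Hilbert function `HF(M; j) = dim_k M_j`. -/
noncomputable def hilbertFn {k : Type*} [Field k] {M : Type*} [AddCommGroup M] [Module k M]
    (ℳ : ℤ → Submodule k M) (j : ℤ) : ℕ :=
  Module.finrank k (ℳ j)

/-- The cumulative Hilbert function `∑_{i ≤ j} HF(M; i)`. For a finitely generated graded module
the pieces are finite-dimensional and vanish in very negative degrees, so the sum is finite. -/
noncomputable def hilbertSum {k : Type*} [Field k] {M : Type*} [AddCommGroup M] [Module k M]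
    (ℳ : ℤ → Submodule k M) (j : ℤ) : ℕ :=
  ∑ᶠ (i : ℤ) (_ : i ≤ j), hilbertFn ℳ i

/-- `∑_{i ≤ j} HF(M; i) = (e / d!) j ^ d + O(j ^ (d - 1))` as `j → +∞`.
The exponent `d - 1` is an integer, so that for `d = 0` the error term is `O(1 / j)`. -/
def HasHilbertAsymptotics {k : Type*} [Field k] {M : Type*} [AddCommGroup M] [Module k M]
    (ℳ : ℤ → Submodule k M) (d : ℕ) (e : ℤ) : Prop :=
  (fun j : ℤ => (hilbertSum ℳ j : ℝ) - (e : ℝ) / (d.factorial : ℝ) * (j : ℝ) ^ d)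
    =O[Filter.atTop] (fun j : ℤ => (j : ℝ) ^ ((d : ℤ) - 1))

/-- The asymptotic expansion determines its leading coefficient. -/
theorem HasHilbertAsymptotics.unique {k : Type*} [Field k] {M : Type*} [AddCommGroup M]
    [Module k M] {ℳ : ℤ → Submodule k M} {d : ℕ} {e e' : ℤ}
    (h : HasHilbertAsymptotics ℳ d e) (h' : HasHilbertAsymptotics ℳ d e') : e = e' := by
  have h1 := h.sub h'
  have h2 : (fun _ : ℤ => ((e' : ℝ) - e) / (d.factorial : ℝ)) =O[Filter.atTop]
      (fun j : ℤ => (j : ℝ)⁻¹) := by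
    have h3 := h1.mul (Asymptotics.isBigO_refl (fun j : ℤ => ((j : ℝ) ^ d)⁻¹) Filter.atTop)
    refine (h3.congr' ?_ ?_)
    · filter_upwards [Filter.eventually_gt_atTop (0 : ℤ)] with j hj
      have : (j : ℝ) ≠ 0 := by exact_mod_cast hj.ne'
      have : (d.factorial : ℝ) ≠ 0 := by exact_mod_cast d.factorial_ne_zero
      field_simp
      ring
    · filter_upwards [Filter.eventually_gt_atTop (0 : ℤ)] with j hj
      have : (j : ℝ) ≠ 0 := by exact_mod_cast hj.ne'
      rw [zpow_sub₀ this]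
      field_simp
      simp
  have h4 : Filter.Tendsto (fun j : ℤ => (j : ℝ)⁻¹) Filter.atTop (nhds 0) :=
    tendsto_inv_atTop_zero.comp tendsto_intCast_atTop_atTop
  have h5 := tendsto_nhds_unique (h2.trans_tendsto h4) tendsto_const_nhds
  have : (d.factorial : ℝ) ≠ 0 := by exact_mod_cast d.factorial_ne_zero
  have h6 : (e' : ℝ) - e = 0 := by
    rcases div_eq_zero_iff.1 h5.symm with h | h
    · exact h
    · exact absurd h this
  have h7 : (e : ℝ) = e' := by linarith
  exact_mod_cast h7

/-- For a graded `S`-module `M` of Krull dimension `d` (as an `S`-module), `gradedE n ℳ r` is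
`e_r(M)`: it is the multiplicity `e(M)` if `r = d`, that is, the positive integer `e` with
`∑_{i ≤ j} HF(M; i) = (e / d!) j ^ d + O(j ^ (d - 1))`, and it is `0` if `r ≠ d`. -/
noncomputable def gradedE {k : Type*} [Field k] (n : ℕ) {M : Type*} [AddCommGroup M]
    [Module k M] [Module (MvPolynomial (Fin n) k) M] (ℳ : ℤ → Submodule k M) (r : ℕ) : ℤ :=
  open Classical in
  if h : Module.supportDim (MvPolynomial (Fin n) k) M = (r : WithBot ℕ∞) ∧
      ∃ e : ℤ, 0 < e ∧ HasHilbertAsymptotics ℳ r e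
  then h.2.choose else 0

/-- The depth of a graded `S`-module: the supremum of the lengths of the `M`-regular sequences
contained in the homogeneous maximal ideal `𝔪 = (x₁, …, xₙ)`. -/
noncomputable def gradedDepth (k : Type*) [Field k] (n : ℕ) (M : Type*) [AddCommGroup M]
    [Module (MvPolynomial (Fin n) k) M] : ℕ∞ :=
  ⨆ (rs : List (MvPolynomial (Fin n) k))
    (_ : RingTheory.Sequence.IsRegular M rs ∧
      ∀ r ∈ rs, r ∈ Ideal.span (Set.range (X : Fin n → MvPolynomial (Fin n) k))),
    (rs.length : ℕ∞)

/-- A (finitely generated graded) `S`-module is Cohen–Macaulay if it is nonzero and its depth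
is equal to its Krull dimension. -/
def IsGradedCM (k : Type*) [Field k] (n : ℕ) (M : Type*) [AddCommGroup M]
    [Module (MvPolynomial (Fin n) k) M] : Prop :=
  Nontrivial M ∧
    (gradedDepth k n M : WithBot ℕ∞) = Module.supportDim (MvPolynomial (Fin n) k) M

/-- The grading that the quotient `M / ℓ M` inherits from `M`: its piece of degree `j` is the
image of `ℳ j`. -/
noncomputable def quotGrading {k : Type*} [Field k] {n : ℕ} {M : Type*} [AddCommGroup M] [Module k M]
    [Module (MvPolynomial (Fin n) k) M] [IsScalarTower k (MvPolynomial (Fin n) k) M]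
    (ℳ : ℤ → Submodule k M) (ℓ : MvPolynomial (Fin n) k) (j : ℤ) :
    Submodule k (QuotSMulTop ℓ M) :=
  (ℳ j).map
    ((ℓ • (⊤ : Submodule (MvPolynomial (Fin n) k) M)).mkQ.restrictScalars k)

/-! ### Dimension under integral extensions, and dimension bounds from regular sequences. -/

section CommutativeAlgebra

open Module

/-! Let `K` be the `ℓ`-torsion of `M`, let `d = t + 1`, and let `H` denote cumulative Hilbert
functions. The exact sequence `0 → K(-1) → M(-1) → M → M/ℓM → 0` gives `ΔH_M(j) = H_{M/ℓM}(j+1) -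
H_K(j)` (`hilbertSum_quotGrading_add`). After `t` more differences the equal multiplicities cancel,
so `Δ^t H_K` is eventually zero: `K` is zero or has dimension less than `t`.

On the other hand a nonzero `K` has dimension at least `t` (`length_le_supportDim_torsionBy`). Let
`V` be the set of elements killed by a power of `ℓ`. It is saturated, so `V/ℓV` embeds in `M/ℓM`,
and by Nakayama it is nonzero at `𝔪`. A regular sequence of length `t` in `𝔪` on `M/ℓM` forces every
submodule supported at `𝔪` to have dimension at least `t` (`length_le_supportDim_of_mem_support`,
which saturates and cuts by one element at a time). As `Supp V ⊆ Supp K`, also `dim K ≥ t`. Hence `K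
= 0`. Prepending `ℓ` to the regular sequence gives depth at least `d`, and the same dimension bound
applied to `M` itself gives depth at most `d`.

Dimension is tied to differences of `H` by `exists_pos_fwdDiff_iter_hilbertSum`. Killing the
variables one by one shows that some iterated difference vanishes eventually. Noether normalization
of `S / ann M` shows that `H` grows exactly like `j ^ dim M`. Together these make the difference of
order `dim M` eventually a positive constant. -/

theorem exists_ltSeries_over_of_isIntegral {R A : Type*} [CommRing R] [CommRing A] [Algebra R A]
    [Algebra.IsIntegral R A] (p : LTSeries (PrimeSpectrum R)) :
    ∀ Q : PrimeSpectrum A, PrimeSpectrum.comap (algebraMap R A) Q = p.head →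
      ∃ q : LTSeries (PrimeSpectrum A), q.head = Q ∧ q.length = p.length := by
  induction p using RelSeries.inductionOn with
  | singleton x => exact fun Q _ => ⟨RelSeries.singleton _ Q, rfl, rfl⟩
  | cons p x hx ih =>
    intro Q hQ
    have hQ' : Q.asIdeal.comap (algebraMap R A) = x.asIdeal := by
      simpa using congrArg PrimeSpectrum.asIdeal hQ
    have hlt : x < p.head := hx
    obtain ⟨J, hJ, hJp, hJc⟩ := Ideal.exists_ideal_over_prime_of_isIntegral_of_isPrime
      p.head.asIdeal Q.asIdeal (hQ'.trans_le hlt.le)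
    obtain ⟨q, hq, hl⟩ := ih ⟨J, hJp⟩ (PrimeSpectrum.ext hJc)
    have hQJ : Q < q.head := by
      rw [hq]
      refine lt_of_le_of_ne hJ fun h => hlt.ne (PrimeSpectrum.ext ?_)
      rw [← hJc, ← hQ', h]
    exact ⟨q.cons Q hQJ, by simp, by simp [hl]⟩

/-- Incomparability gives `≤`; lying over for the bottom prime of a chain, followed by going up,
gives `≥`. -/
theorem ringKrullDim_eq_of_isIntegral_of_injective {R A : Type*} [CommRing R] [CommRing A]
    [Algebra R A] [Algebra.IsIntegral R A] (h : Function.Injective (algebraMap R A)) :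
    ringKrullDim A = ringKrullDim R := by
  refine le_antisymm ?_ ?_
  · refine Order.krullDim_le_of_strictMono (PrimeSpectrum.comap (algebraMap R A)) fun I J hIJ => ?_
    exact Ideal.IsIntegral.comap_lt_comap hIJ
  · refine iSup_le fun p => ?_
    obtain ⟨Q, _, hQp, hQ⟩ := Ideal.exists_ideal_over_prime_of_isIntegral (S := A)
      p.head.asIdeal ⊥ (by
        intro x hx
        have : x = 0 := h (by simpa using hx)
        simp [this])
    obtain ⟨q, -, hq⟩ := exists_ltSeries_over_of_isIntegral (A := A) p ⟨Q, hQp⟩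
      (PrimeSpectrum.ext hQ)
    rw [← hq]
    exact Order.LTSeries.length_le_krullDim q

theorem supportDim_le_of_support_subset {R M N : Type*} [CommRing R] [AddCommGroup M] [Module R M]
    [AddCommGroup N] [Module R N] (h : support R M ⊆ support R N) :
    supportDim R M ≤ supportDim R N :=
  Order.krullDim_le_of_strictMono (fun a => ⟨a.1, h a.2⟩) fun {_ _} lt => lt

/-- The saturation of a submodule with respect to an element of the ring. -/
def Submodule.saturationBy {R M : Type*} [CommRing R] [AddCommGroup M] [Module R M]
    (U : Submodule R M) (a : R) : Submodule R M where
  carrier := {m | ∃ i : ℕ, a ^ i • m ∈ U}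
  zero_mem' := ⟨0, by simp⟩
  add_mem' := by
    rintro x y ⟨i, hi⟩ ⟨j, hj⟩
    refine ⟨i + j, ?_⟩
    rw [smul_add]
    refine U.add_mem ?_ ?_
    · rw [add_comm, pow_add, mul_smul]
      exact U.smul_mem _ hi
    · rw [pow_add, mul_smul]
      exact U.smul_mem _ hj
  smul_mem' := by
    rintro c x ⟨i, hi⟩
    refine ⟨i, ?_⟩
    rw [smul_comm]
    exact U.smul_mem _ hi

theorem Submodule.le_saturationBy {R M : Type*} [CommRing R] [AddCommGroup M] [Module R M]
    (U : Submodule R M) (a : R) : U ≤ U.saturationBy a :=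
  fun _ hm => ⟨0, by simpa using hm⟩

theorem Submodule.mem_saturationBy_of_smul_mem {R M : Type*} [CommRing R] [AddCommGroup M]
    [Module R M] {U : Submodule R M} {a : R} {m : M} (h : a • m ∈ U.saturationBy a) :
    m ∈ U.saturationBy a := by
  obtain ⟨i, hi⟩ := h
  exact ⟨i + 1, by rwa [pow_succ, mul_smul]⟩

/-- If `a • m` lies in the saturation `V`, so does `m`; hence `aM ∩ V = aV`. -/
theorem QuotSMulTop.map_subtype_saturationBy_injective {R M : Type*} [CommRing R] [AddCommGroup M]
    [Module R M] (U : Submodule R M) (a : R) :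
    Function.Injective (QuotSMulTop.map a (U.saturationBy a).subtype) := by
  rw [injective_iff_map_eq_zero]
  intro x
  obtain ⟨u, rfl⟩ := Submodule.Quotient.mk_surjective _ x
  intro h
  rw [QuotSMulTop.map_apply_mk, Submodule.Quotient.mk_eq_zero,
    Submodule.mem_smul_pointwise_iff_exists] at h
  obtain ⟨m, -, hm⟩ := h
  rw [Submodule.Quotient.mk_eq_zero, Submodule.mem_smul_pointwise_iff_exists]
  refine ⟨⟨m, Submodule.mem_saturationBy_of_smul_mem ?_⟩, trivial, Subtype.ext hm⟩
  rw [hm]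
  exact u.2

/-- Multiplication by `a ^ i` is injective on `M`, so a scalar killing `a ^ i • m ∈ U` already kills
`m`. -/
theorem support_saturationBy_subset {R M : Type*} [CommRing R] [AddCommGroup M]
    [Module R M] (U : Submodule R M) {a : R} (ha : IsSMulRegular M a) :
    support R (U.saturationBy a) ⊆ support R U := by
  intro p
  contrapose
  simp only [notMem_support_iff']
  rintro h ⟨m, i, hi⟩
  obtain ⟨r, hr, hr0⟩ := h ⟨_, hi⟩
  refine ⟨r, hr, Subtype.ext ?_⟩
  have : a ^ i • (r • m) = a ^ i • (0 : M) := by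
    rw [smul_comm, smul_zero]
    exact congrArg Subtype.val hr0
  exact ha.pow i this

/-- A submodule supported at a prime containing a regular sequence of length `r` has
dimension at least `r`. -/
theorem length_le_supportDim_of_mem_support {R : Type*} [CommRing R] [IsNoetherianRing R]
    (p : PrimeSpectrum R) (rs : List R) (hrs : ∀ r ∈ rs, r ∈ p.asIdeal) :
    ∀ {M : Type*} [AddCommGroup M] [Module R M] [Module.Finite R M] (U : Submodule R M),
      RingTheory.Sequence.IsWeaklyRegular M rs → p ∈ support R U →
      (rs.length : WithBot ℕ∞) ≤ supportDim R U := by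
  induction rs with
  | nil =>
    intro M _ _ _ U _ hp
    have : Nonempty (support R U) := ⟨⟨p, hp⟩⟩
    simpa [supportDim] using Order.krullDim_nonneg
  | cons a rs ih =>
    intro M _ _ _ U hreg hp
    rw [RingTheory.Sequence.isWeaklyRegular_cons_iff] at hreg
    let V := U.saturationBy a
    have hpV : p ∈ support R V := support_subset_of_injective
      (Submodule.inclusion (U.le_saturationBy a)) (Submodule.inclusion_injective _) hp
    let f := QuotSMulTop.map a V.subtype
    have hf : Function.Injective f := QuotSMulTop.map_subtype_saturationBy_injective U a
    -- Nakayama at `p`: since `a ∈ p`, cutting by `a` does not remove `p` from the support.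
    have hpQ : p ∈ support R (QuotSMulTop a V) := by
      rw [support_quotSMulTop]
      exact ⟨hpV, by simpa using hrs a (by simp)⟩
    have e : QuotSMulTop a V ≃ₗ[R] LinearMap.range f := LinearEquiv.ofInjective f hf
    have h1 := ih (fun r hr => hrs r (by simp [hr])) (LinearMap.range f) hreg.2
      (e.support_eq ▸ hpQ)
    rw [← supportDim_eq_of_equiv e] at h1
    -- Being `V`-regular, `a` avoids the minimal primes of the support of `V`, so cutting by it
    -- lowers the dimension by at least one.
    have haV : IsSMulRegular V a := fun x y h => Subtype.ext (hreg.1 (congrArg Subtype.val h))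
    have h2 := supportDim_quotSMulTop_succ_le_of_notMem_minimalPrimes (R := R) (M := V) (x := a)
      fun _ => haV.notMem_of_mem_minimalPrimes
    have h3 := supportDim_le_of_support_subset (support_saturationBy_subset U hreg.1)
    refine le_trans ?_ (h2.trans h3)
    rw [List.length_cons, Nat.cast_add, Nat.cast_one]
    gcongr

/-- Here `a` is not regular. If the `a`-torsion vanishes at `p`, then `a` is injective on the
localization, and powers of `a` can be removed one at a time. -/
theorem support_saturationBy_bot_subset {R M : Type*} [CommRing R] [AddCommGroup M]
    [Module R M] (a : R) :
    support R ((⊥ : Submodule R M).saturationBy a) ⊆ support R (Submodule.torsionBy R M a) := by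
  intro p
  contrapose
  simp only [notMem_support_iff']
  intro h
  have key : ∀ (i : ℕ) (m : M), a ^ i • m = 0 → ∃ r ∉ p.asIdeal, r • m = 0 := by
    intro i
    induction i with
    | zero => exact fun m hm => ⟨1, (Ideal.ne_top_iff_one _).1 p.2.ne_top, by simpa using hm⟩
    | succ i ih =>
      intro m hm
      obtain ⟨r, hr, hr0⟩ := h ⟨a ^ i • m, by
        rw [Submodule.mem_torsionBy_iff, ← mul_smul, ← pow_succ', hm]⟩
      obtain ⟨s, hs, hs0⟩ := ih (r • m) (by
        rw [smul_comm]
        exact congrArg Subtype.val hr0)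
      exact ⟨s * r, p.2.mul_notMem hs hr, by rw [mul_smul, hs0]⟩
  rintro ⟨m, i, hi⟩
  obtain ⟨r, hr, hr0⟩ := key i m (by simpa using hi)
  exact ⟨r, hr, Subtype.ext hr0⟩

/-- If a regular sequence of length `r` on `M / a M` lies in a prime `p` of the support of the
`a`-torsion of `M`, where `a ∈ p`, then the `a`-torsion has dimension at least `r`. -/
theorem length_le_supportDim_torsionBy {R M : Type*} [CommRing R] [IsNoetherianRing R]
    [AddCommGroup M] [Module R M] [Module.Finite R M] (p : PrimeSpectrum R) {a : R}
    (ha : a ∈ p.asIdeal) (rs : List R) (hrs : ∀ r ∈ rs, r ∈ p.asIdeal)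
    (hreg : RingTheory.Sequence.IsWeaklyRegular (QuotSMulTop a M) rs)
    (hp : p ∈ support R (Submodule.torsionBy R M a)) :
    (rs.length : WithBot ℕ∞) ≤ supportDim R (Submodule.torsionBy R M a) := by
  let V := (⊥ : Submodule R M).saturationBy a
  have hle : Submodule.torsionBy R M a ≤ V := fun m hm => ⟨1, by simpa using hm⟩
  have hpV : p ∈ support R V := support_subset_of_injective
    (Submodule.inclusion hle) (Submodule.inclusion_injective _) hp
  let f := QuotSMulTop.map a V.subtype
  have hf : Function.Injective f := QuotSMulTop.map_subtype_saturationBy_injective ⊥ a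
  have hpQ : p ∈ support R (QuotSMulTop a V) := by
    rw [support_quotSMulTop]
    exact ⟨hpV, by simpa using ha⟩
  have e : QuotSMulTop a V ≃ₗ[R] LinearMap.range f := LinearEquiv.ofInjective f hf
  have h1 := length_le_supportDim_of_mem_support p rs hrs (LinearMap.range f) hreg
    (e.support_eq ▸ hpQ)
  rw [← supportDim_eq_of_equiv e] at h1
  exact h1.trans ((supportDim_le_of_surjective _ (Submodule.mkQ_surjective _)).trans
    (supportDim_le_of_support_subset (support_saturationBy_bot_subset a)))

end CommutativeAlgebra

/-! ### Growth of integer sequences with eventually constant iterated differences. -/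

section ForwardDifferences

open Filter Asymptotics

theorem eventually_add_one {P : ℤ → Prop} (h : ∀ᶠ j in atTop, P j) : ∀ᶠ j in atTop, P (j + 1) :=
  (tendsto_atTop_add_const_right atTop (1 : ℤ) tendsto_id).eventually h

theorem fwdDiff_eventuallyEq {G : Type*} [AddCommGroup G] {f g : ℤ → G} (h : f =ᶠ[atTop] g) :
    fwdDiff 1 f =ᶠ[atTop] fwdDiff 1 g := by
  filter_upwards [h, eventually_add_one h] with j h1 h2
  simp only [fwdDiff, h1, h2]

theorem fwdDiff_iter_eventuallyEq_zero_of_le {G : Type*} [AddCommGroup G] {f : ℤ → G} {r s : ℕ}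
    (hrs : r ≤ s) (h : (fwdDiff 1)^[r] f =ᶠ[atTop] fun _ => 0) :
    (fwdDiff 1)^[s] f =ᶠ[atTop] fun _ => 0 := by
  induction s, hrs using Nat.le_induction with
  | base => exact h
  | succ s _ ih =>
    rw [Function.iterate_succ_apply']
    exact (fwdDiff_eventuallyEq ih).trans (by simp)

theorem exists_eventuallyEq_const_of_fwdDiff {G : Type*} [AddCommGroup G] {f : ℤ → G}
    (h : fwdDiff 1 f =ᶠ[atTop] fun _ => 0) : ∃ c, f =ᶠ[atTop] fun _ => c := by
  obtain ⟨a, ha⟩ := eventually_atTop.1 h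
  refine ⟨f a, eventually_atTop.2 ⟨a, fun j hj => ?_⟩⟩
  induction j, hj using Int.leInduction with
  | base => rfl
  | succ j hj ih => rw [← ih]; exact sub_eq_zero.1 (ha j hj)

theorem fwdDiff_iter_intCast (f : ℤ → ℤ) (r : ℕ) :
    (fwdDiff 1)^[r] (fun j => (f j : ℝ)) = fun j => (((fwdDiff 1)^[r] f j : ℤ) : ℝ) := by
  induction r with
  | zero => rfl
  | succ r ih =>
    rw [Function.iterate_succ_apply', Function.iterate_succ_apply', ih]
    ext j
    simp [fwdDiff]

/-- Discrete integration: the increments are summed using `j ^ (s+1) + j ^ s ≤ (j+1) ^ (s+1)`. -/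
theorem isBigO_pow_succ_of_fwdDiff {g : ℤ → ℝ} {s : ℕ}
    (h : fwdDiff 1 g =O[atTop] fun j : ℤ => (j : ℝ) ^ s) :
    g =O[atTop] fun j : ℤ => (j : ℝ) ^ (s + 1) := by
  obtain ⟨C, hC⟩ := h.bound
  obtain ⟨a, ha⟩ := eventually_atTop.1 (hC.and (eventually_ge_atTop 1))
  have ha1 : 1 ≤ a := (ha a le_rfl).2
  have hC0 : 0 ≤ C := by
    have h1 := (norm_nonneg _).trans (ha a le_rfl).1
    have : (0 : ℝ) < a := by exact_mod_cast ha1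
    rw [Real.norm_eq_abs, abs_of_pos (by positivity : 0 < (a : ℝ) ^ s)] at h1
    exact nonneg_of_mul_nonneg_left h1 (by positivity)
  have key : ∀ j, a ≤ j → |g j| ≤ |g a| + C * (j : ℝ) ^ (s + 1) := by
    intro j hj
    induction j, hj using Int.leInduction with
    | base =>
      have : (0 : ℝ) < a := by exact_mod_cast ha1
      have : 0 ≤ C * (a : ℝ) ^ (s + 1) := by positivity
      linarith
    | succ j hj ih =>
      have hj0 : (0 : ℝ) < j := by exact_mod_cast ha1.trans hj
      have h1 := (ha j hj).1
      rw [Real.norm_eq_abs, Real.norm_eq_abs, abs_of_pos (by positivity : 0 < (j : ℝ) ^ s)] at h1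
      have h2 : |g (j + 1)| ≤ |g j| + |fwdDiff 1 g j| := by
        have : g (j + 1) = g j + fwdDiff 1 g j := by simp [fwdDiff]
        rw [this]
        exact abs_add_le _ _
      have h3 : (j : ℝ) ^ (s + 1) + (j : ℝ) ^ s ≤ ((j + 1 : ℤ) : ℝ) ^ (s + 1) := by
        push_cast
        calc (j : ℝ) ^ (s + 1) + (j : ℝ) ^ s = (j : ℝ) ^ s * (j + 1) := by ring
          _ ≤ (j + 1 : ℝ) ^ s * (j + 1) := by gcongr; linarith
          _ = _ := by ring
      nlinarith [mul_le_mul_of_nonneg_left h3 hC0]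
  refine IsBigO.of_bound (|g a| + C) ?_
  filter_upwards [eventually_ge_atTop a] with j hj
  have hj1 : (1 : ℝ) ≤ j := by exact_mod_cast ha1.trans hj
  have hp : 1 ≤ (j : ℝ) ^ (s + 1) := one_le_pow₀ hj1
  rw [Real.norm_eq_abs, Real.norm_eq_abs, abs_of_pos (by positivity : 0 < (j : ℝ) ^ (s + 1))]
  nlinarith [key j hj, mul_le_mul_of_nonneg_left hp (abs_nonneg (g a))]

theorem isBigO_of_fwdDiff_iter_eventuallyEq_zero {g : ℤ → ℝ} {r : ℕ}
    (h : (fwdDiff 1)^[r] g =ᶠ[atTop] fun _ => 0) :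
    g =O[atTop] fun j : ℤ => (j : ℝ) ^ ((r : ℤ) - 1) := by
  induction r generalizing g with
  | zero => exact (IsBigO.of_bound 0 (by filter_upwards [h] with j hj; simpa using hj))
  | succ r ih =>
    rw [Function.iterate_succ_apply] at h
    -- The first integration turns an eventually zero function into a constant, not into one of
    -- order `j ^ 0` by the general rule, whose exponents are natural numbers.
    rcases r with _ | r
    · obtain ⟨c, hc⟩ := exists_eventuallyEq_const_of_fwdDiff h
      simpa using hc.trans_isBigO (isBigO_const_const c (one_ne_zero (α := ℝ)) atTop)
    · have h1 := ih h
      have h2 : g =O[atTop] fun j : ℤ => (j : ℝ) ^ (r + 1) :=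
        isBigO_pow_succ_of_fwdDiff (by simpa using h1)
      refine h2.congr_right fun j => ?_
      rw [← zpow_natCast]
      push_cast
      congr 1
      ring

theorem fwdDiff_iter_intCast_pow (r : ℕ) :
    (fwdDiff 1)^[r] (fun j : ℤ => (j : ℝ) ^ r) = fun _ => (r.factorial : ℝ) := by
  have h := fwdDiff_iter_intCast (fun j => j ^ r) r
  rw [fwdDiff_iter_eq_factorial] at h
  simpa using h

/-- The `r`-th difference of `j ^ r` is `r!`, so subtracting the leading term leaves a function with
eventually zero `r`-th difference. -/
theorem isBigO_sub_of_fwdDiff_iter_eventuallyEq {f : ℤ → ℤ} {r : ℕ} {e : ℤ}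
    (h : (fwdDiff 1)^[r] f =ᶠ[atTop] fun _ => e) :
    (fun j : ℤ => (f j : ℝ) - (e : ℝ) / (r.factorial : ℝ) * (j : ℝ) ^ r) =O[atTop]
      fun j : ℤ => (j : ℝ) ^ ((r : ℤ) - 1) := by
  apply isBigO_of_fwdDiff_iter_eventuallyEq_zero
  have heq : (fun j : ℤ => (f j : ℝ) - (e : ℝ) / (r.factorial : ℝ) * (j : ℝ) ^ r) =
      (fun j : ℤ => (f j : ℝ)) + (-((e : ℝ) / (r.factorial : ℝ))) • fun j : ℤ => (j : ℝ) ^ r := by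
    ext j
    simp [sub_eq_add_neg]
  rw [heq, fwdDiff_iter_add, fwdDiff_iter_const_smul, fwdDiff_iter_intCast_pow,
    fwdDiff_iter_intCast]
  filter_upwards [h] with j hj
  have : (r.factorial : ℝ) ≠ 0 := by exact_mod_cast r.factorial_ne_zero
  simp [hj, this]

theorem tendsto_div_pow_of_fwdDiff_iter_eventuallyEq {f : ℤ → ℤ} {r : ℕ} {e : ℤ}
    (h : (fwdDiff 1)^[r] f =ᶠ[atTop] fun _ => e) :
    Tendsto (fun j : ℤ => (f j : ℝ) / (j : ℝ) ^ r) atTop (nhds ((e : ℝ) / r.factorial)) := by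
  have h1 := (isBigO_sub_of_fwdDiff_iter_eventuallyEq h).mul
    (isBigO_refl (fun j : ℤ => ((j : ℝ) ^ r)⁻¹) atTop)
  have h4 : Tendsto (fun j : ℤ => (j : ℝ)⁻¹) atTop (nhds 0) :=
    tendsto_inv_atTop_zero.comp tendsto_intCast_atTop_atTop
  have h2 : (fun j : ℤ => (f j : ℝ) / (j : ℝ) ^ r - (e : ℝ) / r.factorial) =O[atTop]
      fun j : ℤ => (j : ℝ)⁻¹ := by
    refine h1.congr' ?_ ?_
    · filter_upwards [eventually_gt_atTop (0 : ℤ)] with j hj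
      have : (j : ℝ) ≠ 0 := by exact_mod_cast hj.ne'
      field_simp
    · filter_upwards [eventually_gt_atTop (0 : ℤ)] with j hj
      have : (j : ℝ) ≠ 0 := by exact_mod_cast hj.ne'
      rw [zpow_sub₀ this]
      field_simp
      simp
  simpa using (h2.trans_tendsto h4).add_const ((e : ℝ) / r.factorial)

theorem eq_zero_of_fwdDiff_iter_eventuallyEq_of_isBigO {f : ℤ → ℤ} {r d : ℕ} {e : ℤ} (hdr : d < r)
    (h : (fwdDiff 1)^[r] f =ᶠ[atTop] fun _ => e)
    (hf : (fun j => (f j : ℝ)) =O[atTop] fun j : ℤ => (j : ℝ) ^ d) : e = 0 := by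
  have h1 := tendsto_div_pow_of_fwdDiff_iter_eventuallyEq h
  have h2 : (fun j => (f j : ℝ)) =o[atTop] fun j : ℤ => (j : ℝ) ^ r :=
    hf.trans_isLittleO ((isLittleO_pow_pow_atTop_of_lt hdr).comp_tendsto
      tendsto_intCast_atTop_atTop)
  have h3 := tendsto_nhds_unique h1 h2.tendsto_div_nhds_zero
  have : (r.factorial : ℝ) ≠ 0 := by exact_mod_cast r.factorial_ne_zero
  simpa [this] using h3

theorem pos_of_fwdDiff_iter_eventuallyEq_of_pow_le {f : ℤ → ℤ} {d c : ℕ} {e : ℤ} (hc : 0 < c)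
    (h : (fwdDiff 1)^[d] f =ᶠ[atTop] fun _ => e)
    (hf : ∀ j : ℕ, 1 ≤ j → (j : ℤ) ^ d ≤ f (c * j)) : 0 < e := by
  have h1 := tendsto_div_pow_of_fwdDiff_iter_eventuallyEq h
  have h2 : Tendsto (fun j : ℕ => (c * j : ℤ)) atTop atTop :=
    tendsto_natCast_atTop_atTop.const_mul_atTop' (by exact_mod_cast hc)
  have h3 := h1.comp h2
  have hc' : (0 : ℝ) < c := by exact_mod_cast hc
  have h4 : 1 / (c : ℝ) ^ d ≤ (e : ℝ) / d.factorial := by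
    refine ge_of_tendsto h3 ?_
    filter_upwards [eventually_ge_atTop 1] with j hj
    have hj' : (0 : ℝ) < j := by exact_mod_cast hj
    have h5 : (j : ℝ) ^ d ≤ (f (c * j) : ℝ) := by exact_mod_cast hf j hj
    simp only [Function.comp]
    push_cast
    rw [mul_pow, div_le_div_iff₀ (by positivity) (by positivity)]
    nlinarith [mul_le_mul_of_nonneg_left h5 (by positivity : 0 ≤ (c : ℝ) ^ d)]
  have h6 : 0 < (e : ℝ) / d.factorial := lt_of_lt_of_le (by positivity) h4
  have h7 : (0 : ℝ) < e := by
    have : (0 : ℝ) < d.factorial := by exact_mod_cast d.factorial_pos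
    exact (div_pos_iff_of_pos_right this).1 h6
  exact_mod_cast h7

/-- An integer sequence with eventually constant iterated differences and of exact polynomial
growth rate `d` has eventually constant and positive `d`-th difference. -/
theorem exists_pos_fwdDiff_iter_eventuallyEq {f : ℤ → ℤ} {d c N : ℕ} (hc : 0 < c)
    (hN : (fwdDiff 1)^[N] f =ᶠ[atTop] fun _ => 0)
    (hupper : (fun j => (f j : ℝ)) =O[atTop] fun j : ℤ => (j : ℝ) ^ d)
    (hlower : ∀ j : ℕ, 1 ≤ j → (j : ℤ) ^ d ≤ f (c * j)) :
    ∃ e : ℤ, 0 < e ∧ (fwdDiff 1)^[d] f =ᶠ[atTop] fun _ => e := by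
  -- Descent on the order of the difference: a vanishing difference makes the previous one
  -- eventually constant, and above order `d` the upper bound forces that constant to be zero.
  have key : ∀ i : ℕ, (fwdDiff 1)^[d + 1 + i] f =ᶠ[atTop] (fun _ => 0) →
      (fwdDiff 1)^[d + 1] f =ᶠ[atTop] fun _ => 0 := by
    intro i
    induction i with
    | zero => exact id
    | succ i ih =>
      intro h
      rw [← add_assoc, Function.iterate_succ_apply'] at h
      obtain ⟨e, he⟩ := exists_eventuallyEq_const_of_fwdDiff h
      have h0 := eq_zero_of_fwdDiff_iter_eventuallyEq_of_isBigO (by omega) he hupper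
      subst h0
      exact ih he
  have h1 := key N (fwdDiff_iter_eventuallyEq_zero_of_le (by omega) hN)
  rw [Function.iterate_succ_apply'] at h1
  obtain ⟨e, he⟩ := exists_eventuallyEq_const_of_fwdDiff h1
  exact ⟨e, pos_of_fwdDiff_iter_eventuallyEq_of_pow_le hc he hlower, he⟩

end ForwardDifferences

/-! ### Graded pieces, torsion and quotient gradings, and additivity of Hilbert functions. -/

section GradedModules

open Module

section Projection

variable {k : Type*} [Field k] {M : Type*} [AddCommGroup M] [Module k M] {ℳ : ℤ → Submodule k M}

/-- The projection of an internally graded vector space onto its piece of degree `j`. -/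
noncomputable def gradedProj (h : DirectSum.IsInternal ℳ) (j : ℤ) : M →ₗ[k] M :=
  (ℳ j).subtype ∘ₗ DirectSum.component k ℤ (fun i => ℳ i) j ∘ₗ
    (LinearEquiv.ofBijective (DirectSum.coeLinearMap ℳ) h).symm.toLinearMap

theorem gradedProj_mem (h : DirectSum.IsInternal ℳ) (j : ℤ) (m : M) : gradedProj h j m ∈ ℳ j :=
  Subtype.prop _

theorem gradedProj_of_mem (h : DirectSum.IsInternal ℳ) {j : ℤ} {m : M} (hm : m ∈ ℳ j) :
    gradedProj h j m = m := by
  simp only [gradedProj, LinearMap.comp_apply]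
  exact congrArg Subtype.val (h.ofBijective_coeLinearMap_of_mem hm)

theorem gradedProj_of_mem_ne (h : DirectSum.IsInternal ℳ) {i j : ℤ} (hij : i ≠ j) {m : M}
    (hm : m ∈ ℳ i) : gradedProj h j m = 0 := by
  simp only [gradedProj, LinearMap.comp_apply]
  exact congrArg Subtype.val (h.ofBijective_coeLinearMap_of_mem_ne hij hm)

theorem exists_eq_sum_gradedProj (h : DirectSum.IsInternal ℳ) (m : M) :
    ∃ s : Finset ℤ, m = ∑ j ∈ s, gradedProj h j m := by
  have hm : m ∈ ⨆ j, ℳ j := h.submodule_iSup_eq_top ▸ Submodule.mem_top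
  obtain ⟨f, hf⟩ := (Submodule.mem_iSup_iff_exists_finsupp _ _).1 hm
  obtain ⟨hf, rfl⟩ := hf
  refine ⟨f.support, Finset.sum_congr rfl fun j hj => ?_⟩
  rw [Finsupp.sum, map_sum, Finset.sum_eq_single j]
  · exact (gradedProj_of_mem h (hf j)).symm
  · exact fun i _ hij => gradedProj_of_mem_ne h hij (hf i)
  · exact fun hj' => absurd hj hj'

theorem gradedProj_eq_zero_imp (h : DirectSum.IsInternal ℳ) {m : M}
    (hm : ∀ j, gradedProj h j m = 0) : m = 0 := by
  obtain ⟨s, hs⟩ := exists_eq_sum_gradedProj h m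
  rw [hs]
  exact Finset.sum_eq_zero fun j _ => hm j

/-- The maps `q j` stand in for projections: `q j` kills every other piece and is injective on `ℳ
j`, whence independence. -/
theorem isInternal_of_separating {L : Type*} [AddCommGroup L] [Module k L] (q : ℤ → M →ₗ[k] L)
    (hinj : ∀ j, ∀ m ∈ ℳ j, q j m = 0 → m = 0) (hne : ∀ i j, i ≠ j → ∀ m ∈ ℳ i, q j m = 0)
    (htop : ∀ m, m ∈ ⨆ j, ℳ j) : DirectSum.IsInternal ℳ := by
  refine DirectSum.isInternal_submodule_of_iSupIndep_of_iSup_eq_top ?_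
    (eq_top_iff.2 fun m _ => htop m)
  rw [iSupIndep_def]
  intro j
  rw [Submodule.disjoint_def]
  intro m hm hm'
  refine hinj j m hm ?_
  have hle : ⨆ i, ⨆ (_ : i ≠ j), ℳ i ≤ LinearMap.ker (q j) :=
    iSup₂_le fun i hi m hm => hne i j hi m hm
  exact hle hm'

/-- The part of degree at most `j` of a graded vector space. -/
def gradedLE (ℳ : ℤ → Submodule k M) (j : ℤ) : Submodule k M :=
  ⨆ (i : ℤ) (_ : i ≤ j), ℳ i

theorem le_gradedLE {i j : ℤ} (hij : i ≤ j) : ℳ i ≤ gradedLE ℳ j :=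
  le_iSup₂ (f := fun (i : ℤ) (_ : i ≤ j) => ℳ i) i hij

theorem gradedLE_mono {i j : ℤ} (hij : i ≤ j) : gradedLE ℳ i ≤ gradedLE ℳ j :=
  iSup₂_le fun _ h => le_gradedLE (h.trans hij)

theorem exists_mem_gradedLE (h : DirectSum.IsInternal ℳ) (m : M) : ∃ j, m ∈ gradedLE ℳ j := by
  obtain ⟨s, hs⟩ := exists_eq_sum_gradedProj h m
  obtain ⟨b, hb⟩ := s.exists_le
  refine ⟨b, ?_⟩
  rw [hs]
  exact Submodule.sum_mem _ fun j hj => le_gradedLE (hb j hj) (gradedProj_mem h j m)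

theorem gradedProj_eq_zero_of_mem_gradedLE (h : DirectSum.IsInternal ℳ) {i j : ℤ} (hij : i < j)
    {m : M} (hm : m ∈ gradedLE ℳ i) : gradedProj h j m = 0 := by
  have hle : gradedLE ℳ i ≤ LinearMap.ker (gradedProj h j) :=
    iSup₂_le fun l hl m hm => gradedProj_of_mem_ne h (by omega) hm
  exact hle hm

theorem gradedLE_add_one (j : ℤ) : gradedLE ℳ (j + 1) = gradedLE ℳ j ⊔ ℳ (j + 1) := by
  refine le_antisymm (iSup₂_le fun i hi => ?_)
    (sup_le (gradedLE_mono (by omega)) (le_gradedLE le_rfl))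
  rcases hi.lt_or_eq with h | rfl
  · exact (le_gradedLE (by omega)).trans le_sup_left
  · exact le_sup_right

theorem hilbertSum_eq_zero {a : ℤ} (ha : ∀ i < a, ℳ i = ⊥) {j : ℤ} (hj : j < a) :
    hilbertSum ℳ j = 0 := by
  unfold hilbertSum
  refine finsum_mem_eq_zero_of_forall_eq_zero (s := {i | i ≤ j}) fun i hi => ?_
  have hi : i ≤ j := hi
  rw [hilbertFn, ha i (by omega), finrank_bot]

theorem hilbertSum_add_one {a : ℤ} (ha : ∀ i < a, ℳ i = ⊥) (j : ℤ) :
    hilbertSum ℳ (j + 1) = hilbertSum ℳ j + hilbertFn ℳ (j + 1) := by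
  have key : ∀ l, hilbertSum ℳ l = ∑ i ∈ Finset.Icc a l, hilbertFn ℳ i := by
    intro l
    refine finsum_mem_eq_sum_of_inter_support_eq (s := {i | i ≤ l}) _ ?_
    ext i
    simp only [Set.mem_inter_iff, Set.mem_ofPred_eq, Function.mem_support, Finset.coe_Icc,
      Set.mem_Icc]
    refine ⟨fun h => ⟨⟨?_, h.1⟩, h.2⟩, fun h => ⟨h.1.2, h.2⟩⟩
    by_contra! hlt
    exact h.2 (by rw [hilbertFn, ha i hlt, finrank_bot])
  rw [key, key]
  by_cases h : a ≤ j + 1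
  · have : Finset.Icc a (j + 1) = insert (j + 1) (Finset.Icc a j) := by
      ext i
      simp only [Finset.mem_Icc, Finset.mem_insert]
      omega
    rw [this, Finset.sum_insert (by simp), add_comm]
  · rw [Finset.Icc_eq_empty h, Finset.Icc_eq_empty (by omega), hilbertFn, ha _ (by omega)]
    simp

theorem finiteDimensional_gradedLE {a : ℤ} (ha : ∀ i < a, ℳ i = ⊥)
    (hfin : ∀ i, FiniteDimensional k (ℳ i)) (j : ℤ) : FiniteDimensional k (gradedLE ℳ j) := by
  have hle : gradedLE ℳ j ≤ ⨆ i : Finset.Icc a j, ℳ i := by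
    refine iSup₂_le fun i hi => ?_
    by_cases h : a ≤ i
    · exact le_iSup (fun i : Finset.Icc a j => ℳ i) ⟨i, by simp [h, hi]⟩
    · rw [ha i (by omega)]
      exact bot_le
  exact Submodule.finiteDimensional_of_le hle

/-- Turns the cumulative Hilbert function into the dimension of one subspace, so that growth bounds
follow from inclusions. -/
theorem finrank_gradedLE (h : DirectSum.IsInternal ℳ) {a : ℤ} (ha : ∀ i < a, ℳ i = ⊥)
    (hfin : ∀ i, FiniteDimensional k (ℳ i)) (j : ℤ) :
    finrank k (gradedLE ℳ j) = hilbertSum ℳ j := by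
  have hbot : ∀ j < a, finrank k (gradedLE ℳ j) = hilbertSum ℳ j := by
    intro j hj
    have : gradedLE ℳ j = ⊥ := by
      rw [eq_bot_iff]
      exact iSup₂_le fun i hi => (ha i (by omega)).le
    rw [hilbertSum_eq_zero ha hj, this, finrank_bot]
  by_cases hj : j < a
  · exact hbot j hj
  have hj : a - 1 ≤ j := by omega
  induction j, hj using Int.leInduction with
  | base => exact hbot _ (by omega)
  | succ j hj ih =>
    have ih : finrank k (gradedLE ℳ j) = hilbertSum ℳ j := by
      by_cases hj : j < a
      · exact hbot j hj
      · exact ih hj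
    have := finiteDimensional_gradedLE ha hfin j
    have := hfin (j + 1)
    have hdisj : gradedLE ℳ j ⊓ ℳ (j + 1) = ⊥ := by
      rw [eq_bot_iff]
      rintro m ⟨h1, h2⟩
      have h3 := gradedProj_eq_zero_of_mem_gradedLE h (lt_add_one j) h1
      rwa [gradedProj_of_mem h h2] at h3
    have h1 := Submodule.finrank_sup_add_finrank_inf_eq (gradedLE ℳ j) (ℳ (j + 1))
    rw [hdisj, finrank_bot, add_zero] at h1
    rw [gradedLE_add_one, h1, ih, hilbertSum_add_one ha, hilbertFn]

end Projection

variable {k : Type*} [Field k] {n : ℕ} {M : Type*} [AddCommGroup M] [Module k M]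
  [Module (MvPolynomial (Fin n) k) M] [IsScalarTower k (MvPolynomial (Fin n) k) M]
  {ℳ : ℤ → Submodule k M}

omit [IsScalarTower k (MvPolynomial (Fin n) k) M] in
theorem gradedProj_smul (hℳ : IsGradedPolyModule (n := n) ℳ) {i : ℕ}
    {f : MvPolynomial (Fin n) k} (hf : f.IsHomogeneous i) (j : ℤ) (m : M) :
    gradedProj hℳ.isInternal (i + j) (f • m) = f • gradedProj hℳ.isInternal j m := by
  have hm : m ∈ ⨆ l, ℳ l := hℳ.isInternal.submodule_iSup_eq_top ▸ Submodule.mem_top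
  induction hm using Submodule.iSup_induction' with
  | mem l m hm =>
    by_cases hl : l = j
    · subst hl
      rw [gradedProj_of_mem _ hm, gradedProj_of_mem _ (hℳ.smul_mem i l f m hf hm)]
    · rw [gradedProj_of_mem_ne _ hl hm, smul_zero,
        gradedProj_of_mem_ne _ (i := i + l) (by omega) (hℳ.smul_mem i l f m hf hm)]
  | zero => simp
  | add x y _ _ hx hy => simp only [smul_add, map_add, hx, hy]

/-- The grading induced on the `ℓ`-torsion submodule. -/
noncomputable def torsionGrading (ℳ : ℤ → Submodule k M) (ℓ : MvPolynomial (Fin n) k) (j : ℤ) :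
    Submodule k (Submodule.torsionBy (MvPolynomial (Fin n) k) M ℓ) :=
  (ℳ j).comap ((Submodule.torsionBy (MvPolynomial (Fin n) k) M ℓ).subtype.restrictScalars k)

theorem mem_torsionGrading {ℓ : MvPolynomial (Fin n) k} {j : ℤ}
    {m : Submodule.torsionBy (MvPolynomial (Fin n) k) M ℓ} :
    m ∈ torsionGrading ℳ ℓ j ↔ (m : M) ∈ ℳ j := Iff.rfl

theorem isGradedPolyModule_torsionGrading (hℳ : IsGradedPolyModule (n := n) ℳ) {i : ℕ}
    {ℓ : MvPolynomial (Fin n) k} (hℓ : ℓ.IsHomogeneous i) :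
    IsGradedPolyModule (n := n) (torsionGrading ℳ ℓ) where
  isInternal := by
    have hK : ∀ j, ∀ m ∈ Submodule.torsionBy (MvPolynomial (Fin n) k) M ℓ,
        gradedProj hℳ.isInternal j m ∈ Submodule.torsionBy (MvPolynomial (Fin n) k) M ℓ := by
      intro j m hm
      rw [Submodule.mem_torsionBy_iff] at hm ⊢
      rw [← gradedProj_smul hℳ hℓ, hm, map_zero]
    refine isInternal_of_separating (fun j => gradedProj hℳ.isInternal j ∘ₗ
      (Submodule.torsionBy (MvPolynomial (Fin n) k) M ℓ).subtype.restrictScalars k) ?_ ?_ ?_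
    · intro j m hm h0
      refine Subtype.ext ?_
      rw [← gradedProj_of_mem hℳ.isInternal (mem_torsionGrading.1 hm)]
      exact h0
    · exact fun i j hij m hm => gradedProj_of_mem_ne hℳ.isInternal hij (mem_torsionGrading.1 hm)
    · intro m
      obtain ⟨s, hs⟩ := exists_eq_sum_gradedProj hℳ.isInternal (m : M)
      have hm : m = ∑ j ∈ s, ⟨gradedProj hℳ.isInternal j m, hK j m m.2⟩ := by
        refine Subtype.ext ?_
        rw [AddSubmonoidClass.coe_finsetSum]
        exact hs
      rw [hm]
      exact Submodule.sum_mem _ fun j _ => Submodule.mem_iSup_of_mem j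
        (mem_torsionGrading.2 (gradedProj_mem _ _ _))
  smul_mem := fun i j f m hf hm => hℳ.smul_mem i j f m hf hm

theorem isGradedPolyModule_quotGrading (hℳ : IsGradedPolyModule (n := n) ℳ) {i : ℕ}
    {ℓ : MvPolynomial (Fin n) k} (hℓ : ℓ.IsHomogeneous i) :
    IsGradedPolyModule (n := n) (quotGrading ℳ ℓ) where
  isInternal := by
    let W : Submodule (MvPolynomial (Fin n) k) M := ℓ • ⊤
    -- The degree `j` projection descends to the quotient because it carries `ℓ • m'` to `ℓ` times
    -- the component of `m'` in degree `j - i`.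
    let q : ℤ → QuotSMulTop ℓ M →ₗ[k] QuotSMulTop ℓ M := fun j =>
      (W.restrictScalars k).liftQ ((W.mkQ.restrictScalars k) ∘ₗ gradedProj hℳ.isInternal j) (by
        intro m hm
        obtain ⟨m', -, rfl⟩ := Submodule.mem_smul_pointwise_iff_exists _ _ _ |>.1 hm
        have h1 := gradedProj_smul hℳ hℓ (j - i) m'
        rw [add_sub_cancel] at h1
        change W.mkQ (gradedProj hℳ.isInternal j (ℓ • m')) = 0
        rw [h1, Submodule.mkQ_apply, Submodule.Quotient.mk_eq_zero]
        exact Submodule.smul_mem_pointwise_smul _ _ _ trivial)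
    have hq : ∀ j m, q j (W.mkQ m) = W.mkQ (gradedProj hℳ.isInternal j m) := fun j m => rfl
    refine isInternal_of_separating q ?_ ?_ ?_
    · rintro j _ ⟨m, hm, rfl⟩ h0
      have h0 : q j (W.mkQ m) = 0 := h0
      rw [hq, gradedProj_of_mem _ hm] at h0
      exact h0
    · rintro i j hij _ ⟨m, hm, rfl⟩
      change q j (W.mkQ m) = 0
      rw [hq, gradedProj_of_mem_ne _ hij hm, map_zero]
    · intro x
      obtain ⟨m, rfl⟩ := Submodule.mkQ_surjective _ x
      obtain ⟨s, hs⟩ := exists_eq_sum_gradedProj hℳ.isInternal m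
      rw [hs, map_sum]
      exact Submodule.sum_mem _ fun j _ => Submodule.mem_iSup_of_mem j
        ⟨_, gradedProj_mem hℳ.isInternal j m, rfl⟩
  smul_mem := by
    rintro i j f _ hf ⟨m, hm, rfl⟩
    exact ⟨f • m, hℳ.smul_mem i j f m hf hm, rfl⟩

/-- Homogeneous components give a finite set of generators compatible with the grading. -/
theorem exists_le_span_monomial_smul [Module.Finite (MvPolynomial (Fin n) k) M]
    (hℳ : IsGradedPolyModule (n := n) ℳ) :
    ∃ (T : Finset M) (a : ℤ), ∀ j, ℳ j ≤ Submodule.span k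
      {x | ∃ t ∈ T, ∃ α : Fin n →₀ ℕ, (α.degree : ℤ) ≤ j - a ∧ x = monomial α (1 : k) • t} := by
  classical
  obtain ⟨T₀, hT₀⟩ := Module.Finite.fg_top (R := MvPolynomial (Fin n) k) (M := M)
  choose s hs using exists_eq_sum_gradedProj hℳ.isInternal
  let T : Finset M := T₀.biUnion fun t => (s t).image fun j => gradedProj hℳ.isInternal j t
  have hT : Submodule.span (MvPolynomial (Fin n) k) (T : Set M) = ⊤ := by
    rw [eq_top_iff, ← hT₀, Submodule.span_le]
    intro t ht
    rw [SetLike.mem_coe, hs t]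
    refine Submodule.sum_mem _ fun j hj => Submodule.subset_span ?_
    exact Finset.mem_biUnion.2 ⟨t, ht, Finset.mem_image_of_mem _ hj⟩
  have hhom : ∀ t ∈ T, ∃ j, t ∈ ℳ j := by
    intro t ht
    obtain ⟨t₀, -, ht⟩ := Finset.mem_biUnion.1 ht
    obtain ⟨j, -, rfl⟩ := Finset.mem_image.1 ht
    exact ⟨j, gradedProj_mem _ _ _⟩
  choose! δ hδ using hhom
  obtain ⟨a, ha⟩ := (T.image δ).finite_toSet.bddBelow
  refine ⟨T, a, fun j m hm => ?_⟩
  -- Quantifying over all multiples `f • m` lets the span induction pass through scalar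
  -- multiplication; the projection discards the terms of wrong degree.
  have key : ∀ m ∈ Submodule.span (MvPolynomial (Fin n) k) (T : Set M),
      ∀ f : MvPolynomial (Fin n) k, gradedProj hℳ.isInternal j (f • m) ∈ Submodule.span k
      {x | ∃ t ∈ T, ∃ α : Fin n →₀ ℕ, (α.degree : ℤ) ≤ j - a ∧ x = monomial α (1 : k) • t} := by
    intro m hm
    induction hm using Submodule.span_induction with
    | mem t ht =>
      intro f
      induction f using MvPolynomial.induction_on' with
      | monomial α c =>
        have hc : monomial α c = c • monomial α (1 : k) := by rw [smul_monomial, smul_eq_mul, mul_one]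
        have hmem := hℳ.smul_mem α.degree (δ t) (monomial α (1 : k)) t
          (isHomogeneous_monomial 1 rfl) (hδ t ht)
        rw [hc, smul_assoc, map_smul]
        refine Submodule.smul_mem _ _ ?_
        by_cases h : (α.degree : ℤ) + δ t = j
        · rw [gradedProj_of_mem _ (h ▸ hmem)]
          refine Submodule.subset_span ⟨t, ht, α, ?_, rfl⟩
          have : a ≤ δ t := ha (Finset.mem_coe.2 (Finset.mem_image_of_mem δ ht))
          omega
        · rw [gradedProj_of_mem_ne _ h hmem]
          exact zero_mem _
      | add p q hp hq => rw [add_smul, map_add]; exact add_mem hp hq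
    | zero => simp
    | add x y _ _ hx hy => intro f; rw [smul_add, map_add]; exact add_mem (hx f) (hy f)
    | smul g x _ ih => intro f; rw [← mul_smul]; exact ih _
  have h := key m (hT ▸ Submodule.mem_top) 1
  rwa [one_smul, gradedProj_of_mem _ hm] at h

omit [Module k M] [IsScalarTower k (MvPolynomial (Fin n) k) M] in
theorem finite_setOf_monomial_smul (T : Finset M) (J : ℤ) :
    {x : M | ∃ t ∈ T, ∃ α : Fin n →₀ ℕ,
      (α.degree : ℤ) ≤ J ∧ x = monomial α (1 : k) • t}.Finite := by
  have hA : {α : Fin n →₀ ℕ | (α.degree : ℤ) ≤ J}.Finite := by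
    refine ((Set.Finite.pi' fun _ : Fin n => Set.finite_le_nat J.toNat).preimage
      DFunLike.coe_injective.injOn).subset fun α hα i => ?_
    have h1 : α i ≤ α.degree := Finsupp.le_degree i α
    have h2 : (α.degree : ℤ) ≤ J := hα
    change α i ≤ J.toNat
    omega
  refine ((T.finite_toSet.prod hA).image fun p => monomial p.2 (1 : k) • p.1).subset ?_
  rintro _ ⟨t, ht, α, hα, rfl⟩
  exact ⟨(t, α), ⟨ht, hα⟩, rfl⟩

theorem exists_forall_eq_bot [Module.Finite (MvPolynomial (Fin n) k) M]
    (hℳ : IsGradedPolyModule (n := n) ℳ) : ∃ a : ℤ, ∀ j < a, ℳ j = ⊥ := by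
  obtain ⟨T, a, h⟩ := exists_le_span_monomial_smul hℳ
  refine ⟨a, fun j hj => eq_bot_iff.2 ((h j).trans (Submodule.span_le.2 ?_))⟩
  rintro _ ⟨t, ht, α, hα, rfl⟩
  omega

theorem finiteDimensional_of_isGradedPolyModule [Module.Finite (MvPolynomial (Fin n) k) M]
    (hℳ : IsGradedPolyModule (n := n) ℳ) (j : ℤ) : FiniteDimensional k (ℳ j) := by
  obtain ⟨T, a, h⟩ := exists_le_span_monomial_smul hℳ
  have := FiniteDimensional.span_of_finite k (finite_setOf_monomial_smul (k := k) (n := n) T (j - a))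
  exact Submodule.finiteDimensional_of_le (h j)

/-- Rank–nullity for `ℓ : M_j → M_{j+1}` and for `M_{j+1} → (M/ℓM)_{j+1}`, the kernel of the second
being the image of the first. -/
theorem hilbertFn_quotGrading_add [Module.Finite (MvPolynomial (Fin n) k) M]
    (hℳ : IsGradedPolyModule (n := n) ℳ) {ℓ : MvPolynomial (Fin n) k} (hℓ : ℓ.IsHomogeneous 1)
    (j : ℤ) : hilbertFn (quotGrading ℳ ℓ) (j + 1) + hilbertFn ℳ j =
      hilbertFn ℳ (j + 1) + hilbertFn (torsionGrading ℳ ℓ) j := by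
  have := finiteDimensional_of_isGradedPolyModule hℳ
  let W : Submodule (MvPolynomial (Fin n) k) M := ℓ • ⊤
  let L : M →ₗ[k] M := (LinearMap.lsmul (MvPolynomial (Fin n) k) M ℓ).restrictScalars k
  have hL : ∀ m, L m = ℓ • m := fun m => rfl
  let f : ℳ j →ₗ[k] M := L ∘ₗ (ℳ j).subtype
  let π : ℳ (j + 1) →ₗ[k] QuotSMulTop ℓ M := (W.mkQ.restrictScalars k) ∘ₗ (ℳ (j + 1)).subtype
  have h1 := f.finrank_range_add_finrank_ker
  have h2 := π.finrank_range_add_finrank_ker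
  have h3 : LinearMap.range π = quotGrading ℳ ℓ (j + 1) := by
    rw [LinearMap.range_comp, Submodule.range_subtype]
    rfl
  have h4 : (LinearMap.ker π).map (ℳ (j + 1)).subtype = LinearMap.range f := by
    ext m
    constructor
    · rintro ⟨⟨m, hm⟩, h0, rfl⟩
      have h0 : W.mkQ m = 0 := h0
      rw [Submodule.mkQ_apply, Submodule.Quotient.mk_eq_zero] at h0
      obtain ⟨m', -, hm'⟩ := Submodule.mem_smul_pointwise_iff_exists _ _ _ |>.1 h0
      -- The preimage `m'` need not be homogeneous; its degree `j` component is also a preimage.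
      refine ⟨⟨_, gradedProj_mem hℳ.isInternal j m'⟩, ?_⟩
      change ℓ • gradedProj hℳ.isInternal j m' = m
      rw [← gradedProj_smul hℳ hℓ, hm', gradedProj_of_mem]
      rwa [Nat.cast_one, add_comm]
    · rintro ⟨⟨m, hm⟩, rfl⟩
      have h5 := hℳ.smul_mem 1 j ℓ m hℓ hm
      rw [Nat.cast_one, add_comm] at h5
      refine ⟨⟨ℓ • m, h5⟩, ?_, rfl⟩
      change W.mkQ (ℓ • m) = 0
      rw [Submodule.mkQ_apply, Submodule.Quotient.mk_eq_zero]
      exact Submodule.smul_mem_pointwise_smul _ _ _ trivial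
  have h5 : finrank k (LinearMap.ker π) = finrank k (LinearMap.range f) := by
    rw [← h4]
    exact (LinearEquiv.finrank_eq
      (Submodule.equivMapOfInjective _ (ℳ (j + 1)).injective_subtype _))
  have h6 : (LinearMap.ker f).map (ℳ j).subtype = (torsionGrading ℳ ℓ j).map
      ((Submodule.torsionBy (MvPolynomial (Fin n) k) M ℓ).subtype.restrictScalars k) := by
    ext m
    constructor
    · rintro ⟨⟨m, hm⟩, h0, rfl⟩
      exact ⟨⟨m, h0⟩, hm, rfl⟩
    · rintro ⟨⟨m, h0⟩, hm, rfl⟩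
      exact ⟨⟨m, hm⟩, h0, rfl⟩
  have h7 : finrank k (LinearMap.ker f) = finrank k (torsionGrading ℳ ℓ j) := by
    have e1 := LinearEquiv.finrank_eq
      (Submodule.equivMapOfInjective _ (ℳ j).injective_subtype (LinearMap.ker f))
    have e2 := LinearEquiv.finrank_eq (Submodule.equivMapOfInjective
      ((Submodule.torsionBy (MvPolynomial (Fin n) k) M ℓ).subtype.restrictScalars k)
      (Submodule.injective_subtype _) (torsionGrading ℳ ℓ j))
    rw [h6] at e1
    exact e1.trans e2.symm
  rw [h3] at h2
  simp only [hilbertFn]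
  omega

theorem quotGrading_eq_bot {ℓ : MvPolynomial (Fin n) k} {j : ℤ} (h : ℳ j = ⊥) :
    quotGrading ℳ ℓ j = ⊥ := by
  rw [quotGrading, h, Submodule.map_bot]

theorem torsionGrading_eq_bot {ℓ : MvPolynomial (Fin n) k} {j : ℤ} (h : ℳ j = ⊥) :
    torsionGrading ℳ ℓ j = ⊥ := by
  rw [eq_bot_iff]
  intro m hm
  rw [mem_torsionGrading, h, Submodule.mem_bot] at hm
  exact Subtype.ext hm

/-- The cumulative form of the exact sequence
`0 → (0 :_M ℓ)(-1) → M(-1) → M → M / ℓ M → 0`. -/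
theorem hilbertSum_quotGrading_add [Module.Finite (MvPolynomial (Fin n) k) M]
    (hℳ : IsGradedPolyModule (n := n) ℳ) {ℓ : MvPolynomial (Fin n) k} (hℓ : ℓ.IsHomogeneous 1)
    (j : ℤ) : hilbertSum (quotGrading ℳ ℓ) (j + 1) + hilbertSum ℳ j =
      hilbertSum ℳ (j + 1) + hilbertSum (torsionGrading ℳ ℓ) j := by
  obtain ⟨a, ha⟩ := exists_forall_eq_bot hℳ
  have hq : ∀ i < a, quotGrading ℳ ℓ i = ⊥ := fun i hi => quotGrading_eq_bot (ha i hi)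
  have ht : ∀ i < a, torsionGrading ℳ ℓ i = ⊥ := fun i hi => torsionGrading_eq_bot (ha i hi)
  by_cases hj : j < a - 1
  · simp only [hilbertSum_eq_zero ha (j := j) (by omega),
      hilbertSum_eq_zero hq (j := j + 1) (by omega), hilbertSum_eq_zero ha (j := j + 1) (by omega),
      hilbertSum_eq_zero ht (j := j) (by omega)]
  -- Starting at `a - 2` makes all four terms of the base case vanish, including those in degree `j
  -- + 1`.
  have hj : a - 2 ≤ j := by omega
  induction j, hj using Int.leInduction with
  | base =>
    simp only [hilbertSum_eq_zero ha (j := a - 2) (by omega),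
      hilbertSum_eq_zero hq (j := a - 2 + 1) (by omega),
      hilbertSum_eq_zero ha (j := a - 2 + 1) (by omega),
      hilbertSum_eq_zero ht (j := a - 2) (by omega)]
  | succ j hj ih =>
    have ih : hilbertSum (quotGrading ℳ ℓ) (j + 1) + hilbertSum ℳ j =
        hilbertSum ℳ (j + 1) + hilbertSum (torsionGrading ℳ ℓ) j := by
      by_cases h : j < a - 1
      · simp only [hilbertSum_eq_zero ha (j := j) (by omega),
          hilbertSum_eq_zero hq (j := j + 1) (by omega),
          hilbertSum_eq_zero ha (j := j + 1) (by omega),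
          hilbertSum_eq_zero ht (j := j) (by omega)]
      · exact ih h
    have h1 := hilbertFn_quotGrading_add hℳ hℓ (j + 1)
    rw [hilbertSum_add_one hq (j + 1), hilbertSum_add_one ha (j + 1), hilbertSum_add_one ht j]
    have h2 := hilbertSum_add_one ha j
    omega

end GradedModules

/-! ### Eventual vanishing of iterated differences. -/

section HilbertPolynomial

open Module Filter

theorem fwdDiff_hilbertSum {k : Type*} [Field k] {n : ℕ} {M : Type*} [AddCommGroup M] [Module k M]
    [Module (MvPolynomial (Fin n) k) M] [IsScalarTower k (MvPolynomial (Fin n) k) M]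
    [Module.Finite (MvPolynomial (Fin n) k) M] {ℳ : ℤ → Submodule k M}
    (hℳ : IsGradedPolyModule (n := n) ℳ) {ℓ : MvPolynomial (Fin n) k} (hℓ : ℓ.IsHomogeneous 1) :
    fwdDiff 1 (fun j => (hilbertSum ℳ j : ℤ)) =
      (fun j => (hilbertSum (quotGrading ℳ ℓ) (j + 1) : ℤ)) +
        (-1 : ℤ) • fun j => (hilbertSum (torsionGrading ℳ ℓ) j : ℤ) := by
  ext j
  have := hilbertSum_quotGrading_add hℳ hℓ j
  simp only [fwdDiff, Pi.add_apply, Pi.smul_apply, smul_eq_mul]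
  omega

/-- Only the constant monomial acts nontrivially, so `M` is spanned over `k` by finitely many
generators, whose degrees are bounded. -/
theorem eventually_eq_bot_of_X_smul_eq_zero {k : Type*} [Field k] {n : ℕ} {M : Type*}
    [AddCommGroup M] [Module k M] [Module (MvPolynomial (Fin n) k) M]
    [IsScalarTower k (MvPolynomial (Fin n) k) M] [Module.Finite (MvPolynomial (Fin n) k) M]
    {ℳ : ℤ → Submodule k M} (hℳ : IsGradedPolyModule (n := n) ℳ)
    (hX : ∀ (i : Fin n) (m : M), (X i : MvPolynomial (Fin n) k) • m = 0) :
    ∀ᶠ j in atTop, ℳ j = ⊥ := by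
  obtain ⟨T, a, hT⟩ := exists_le_span_monomial_smul hℳ
  choose b hb using exists_mem_gradedLE hℳ.isInternal
  obtain ⟨c, hc⟩ := (T.image b).exists_le
  filter_upwards [eventually_gt_atTop c] with j hj
  rw [eq_bot_iff]
  have hle : ℳ j ≤ LinearMap.ker (gradedProj hℳ.isInternal j) := by
    refine (hT j).trans (Submodule.span_le.2 ?_)
    rintro _ ⟨t, ht, α, -, rfl⟩
    by_cases hα : α = 0
    · subst hα
      rw [monomial_zero', C_1, one_smul]
      have := hc (b t) (Finset.mem_image_of_mem b ht)
      exact gradedProj_eq_zero_of_mem_gradedLE _ (by omega) (hb t)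
    · obtain ⟨i, hi⟩ := Finsupp.ne_iff.1 hα
      have hα' : α = Finsupp.single i 1 + (α - Finsupp.single i 1) := by
        rw [add_tsub_cancel_of_le]
        exact Finsupp.single_le_iff.2 (Nat.one_le_iff_ne_zero.2 hi)
      have : monomial α (1 : k) = X i * monomial (α - Finsupp.single i 1) 1 := by
        conv_lhs => rw [hα']
        rw [X, monomial_mul, one_mul]
      rw [this, mul_smul, hX]
      exact zero_mem _
  intro m hm
  rw [Submodule.mem_bot, ← gradedProj_of_mem hℳ.isInternal hm]
  exact hle hm

universe u

/-- Hilbert's induction on the number `t` of variables that may act nontrivially: `X t` kills both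
its torsion and its quotient, and one difference of `H_M` is expressed through these. The order is
`t + 1` because cumulative sums of eventually zero functions are eventually constant. -/
theorem fwdDiff_iter_hilbertSum_of_X_smul_eq_zero {k : Type*} [Field k] {n : ℕ} (t : ℕ) :
    ∀ {M : Type u} [AddCommGroup M] [Module k M] [Module (MvPolynomial (Fin n) k) M]
      [IsScalarTower k (MvPolynomial (Fin n) k) M] [Module.Finite (MvPolynomial (Fin n) k) M]
      {ℳ : ℤ → Submodule k M}, IsGradedPolyModule (n := n) ℳ →
      (∀ (i : Fin n) (m : M), t ≤ i → (X i : MvPolynomial (Fin n) k) • m = 0) →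
      (fwdDiff 1)^[t + 1] (fun j => (hilbertSum ℳ j : ℤ)) =ᶠ[atTop] fun _ => 0 := by
  induction t with
  | zero =>
    intro M _ _ _ _ _ ℳ hℳ hX
    obtain ⟨a, ha⟩ := exists_forall_eq_bot hℳ
    filter_upwards [eventually_add_one
      (eventually_eq_bot_of_X_smul_eq_zero hℳ fun i m => hX i m (Nat.zero_le _))] with j hj
    have h0 : hilbertFn ℳ (j + 1) = 0 := by rw [hilbertFn, hj, finrank_bot]
    simp [fwdDiff, hilbertSum_add_one ha, h0]
  | succ t ih =>
    intro M _ _ _ _ _ ℳ hℳ hX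
    by_cases htn : t < n
    · have hℓ := isHomogeneous_X k (⟨t, htn⟩ : Fin n)
      rw [Function.iterate_succ_apply, fwdDiff_hilbertSum hℳ hℓ, fwdDiff_iter_add,
        fwdDiff_iter_const_smul]
      have h1 := ih (isGradedPolyModule_quotGrading hℳ hℓ) (by
        intro i m hi
        obtain ⟨m, rfl⟩ := Submodule.mkQ_surjective _ m
        rw [← map_smul]
        rcases hi.lt_or_eq with h | h
        · rw [hX i m h, map_zero]
        · obtain rfl : ⟨t, htn⟩ = i := Fin.ext h
          rw [Submodule.mkQ_apply, Submodule.Quotient.mk_eq_zero]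
          exact Submodule.smul_mem_pointwise_smul _ _ _ trivial)
      have h2 := ih (isGradedPolyModule_torsionGrading hℳ hℓ) (by
        intro i m hi
        rcases hi.lt_or_eq with h | h
        · exact Subtype.ext (hX i m h)
        · obtain rfl : ⟨t, htn⟩ = i := Fin.ext h
          exact Subtype.ext m.2)
      filter_upwards [eventually_add_one h1, h2] with j h1 h2
      have h3 := fwdDiff_iter_comp_add (1 : ℤ)
        (fun j => (hilbertSum (quotGrading ℳ (X (⟨t, htn⟩ : Fin n))) j : ℤ)) 1 (t + 1) j
      rw [Pi.add_apply, h3, h1, Pi.smul_apply, h2, smul_zero, add_zero]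
    · refine fwdDiff_iter_eventuallyEq_zero_of_le (Nat.le_succ _) (ih hℳ fun i m hi => ?_)
      omega

end HilbertPolynomial

/-! ### Polynomial growth bounds from Noether normalization. -/

section Growth

open Module Filter

theorem finrank_restrictDegree (k : Type*) [Field k] (s J : ℕ) :
    finrank k (restrictDegree (Fin s) k J) = (J + 1) ^ s := by
  have e : {α : Fin s →₀ ℕ | ∀ i, α i ≤ J} ≃ (Fin s → Fin (J + 1)) :=
    { toFun := fun α i => ⟨α.1 i, Nat.lt_succ_of_le (α.2 i)⟩
      invFun := fun f => ⟨Finsupp.equivFunOnFinite.symm fun i => f i,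
        fun i => Nat.le_of_lt_succ (f i).2⟩
      left_inv := fun α => by ext i; rfl
      right_inv := fun f => by ext i; rfl }
  rw [restrictDegree, finrank_eq_nat_card_basis (basisRestrictSupport k {α : Fin s →₀ ℕ | ∀ i, α i ≤ J}),
    Nat.card_congr e]
  simp

theorem ringKrullDim_eq_of_finite_of_injective {A R : Type*} [CommRing A] [CommRing R]
    {g : A →+* R} (hg : g.Finite) (hinj : Function.Injective g) :
    ringKrullDim R = ringKrullDim A := by
  algebraize [g]
  exact ringKrullDim_eq_of_isIntegral_of_injective hinj

theorem exists_finset_eq_sum_of_finite {A R : Type*} [CommRing A] [CommRing R]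
    {g : A →+* R} (hg : g.Finite) : ∃ G : Finset R, ∀ x, ∃ a : R → A, ∑ r ∈ G, g (a r) * r = x := by
  algebraize [g]
  obtain ⟨G, hG⟩ := Module.Finite.fg_top (R := A) (M := R)
  refine ⟨G, fun x => ?_⟩
  have hx : x ∈ Submodule.span A (G : Set R) := hG ▸ Submodule.mem_top
  obtain ⟨a, -, ha⟩ := Submodule.mem_span_finset.1 hx
  refine ⟨a, ?_⟩
  simp only [Algebra.smul_def] at ha
  exact ha

theorem finrank_finset_sup_le {k V ι : Type*} [Field k] [AddCommGroup V] [Module k V]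
    (s : Finset ι) (f : ι → Submodule k V) (hf : ∀ i, FiniteDimensional k (f i)) :
    finrank k (s.sup f : Submodule k V) ≤ ∑ i ∈ s, finrank k (f i) := by
  classical
  induction s using Finset.induction_on with
  | empty => simp
  | insert i s hi ih =>
    rw [Finset.sup_insert, Finset.sum_insert hi]
    exact (Submodule.finrank_add_le_finrank_add_finrank _ _).trans (by gcongr)

/-- Noether normalization for a quotient of a polynomial ring, lifted to the polynomial ring. -/
theorem exists_noether_normalization {k : Type*} [Field k] {n : ℕ}
    (I : Ideal (MvPolynomial (Fin n) k)) (hI : I ≠ ⊤) :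
    ∃ (s : ℕ) (φ : MvPolynomial (Fin s) k →ₐ[k] MvPolynomial (Fin n) k),
      ringKrullDim (MvPolynomial (Fin n) k ⧸ I) = s ∧ (∀ p, φ p ∈ I → p = 0) ∧
      ∃ F : Finset (MvPolynomial (Fin n) k), ∀ f, ∃ a : MvPolynomial (Fin n) k →
        MvPolynomial (Fin s) k, f - ∑ r ∈ F, φ (a r) * r ∈ I := by
  classical
  have : Nontrivial (MvPolynomial (Fin n) k ⧸ I) := Ideal.Quotient.nontrivial_iff.2 hI
  obtain ⟨s, g, hinj, hfin⟩ := exists_finite_inj_algHom_of_fg k (MvPolynomial (Fin n) k ⧸ I)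
  -- Lifting the images of the variables makes the normalization act on `M` through polynomials in
  -- `S`.
  choose h hh using fun i => Ideal.Quotient.mk_surjective (I := I) (g (X i))
  let φ : MvPolynomial (Fin s) k →ₐ[k] MvPolynomial (Fin n) k := aeval h
  have hφ : ∀ p, Ideal.Quotient.mk I (φ p) = g p := by
    intro p
    have : (Ideal.Quotient.mkₐ k I).comp φ = g := by
      ext i
      simp [φ, hh]
    exact DFunLike.congr_fun this p
  refine ⟨s, φ, ?_, ?_, ?_⟩
  · rw [ringKrullDim_eq_of_finite_of_injective hfin hinj,
      MvPolynomial.ringKrullDim_of_isNoetherianRing, ringKrullDim_eq_zero_of_field]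
    simp
  · intro p hp
    refine hinj ?_
    rw [map_zero, ← hφ, Ideal.Quotient.eq_zero_iff_mem.2 hp]
  · obtain ⟨G, hG⟩ := exists_finset_eq_sum_of_finite hfin
    choose l hl using Ideal.Quotient.mk_surjective (I := I)
    refine ⟨G.image l, fun f => ?_⟩
    obtain ⟨a, ha⟩ := hG (Ideal.Quotient.mk I f)
    refine ⟨fun r => a (Ideal.Quotient.mk I r), ?_⟩
    rw [← Ideal.Quotient.eq_zero_iff_mem, map_sub, map_sum, ← ha, sub_eq_zero,
      Finset.sum_image fun x _ y _ hxy => by rw [← hl x, hxy, hl]]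
    refine Finset.sum_congr rfl fun r _ => ?_
    simp only [map_mul, hφ, hl]
    rfl

theorem totalDegree_aeval_le {k : Type*} [Field k] {n s : ℕ}
    (h : Fin s → MvPolynomial (Fin n) k) {J : ℕ} {p : MvPolynomial (Fin s) k}
    (hp : p ∈ restrictDegree (Fin s) k J) :
    (aeval h p).totalDegree ≤ (∑ i, (h i).totalDegree) * J := by
  rw [mem_restrictDegree] at hp
  rw [aeval_def, eval₂_eq']
  refine (totalDegree_finsetSum _ _).trans (Finset.sup_le fun α hα => ?_)
  refine (totalDegree_mul _ _).trans ?_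
  rw [algebraMap_eq, totalDegree_C, zero_add, Finset.sum_mul]
  refine (totalDegree_finsetProd _ _).trans (Finset.sum_le_sum fun i _ => ?_)
  refine (totalDegree_pow _ _).trans ?_
  rw [mul_comm]
  exact Nat.mul_le_mul_left _ (hp α hα i)

theorem mul_mem_restrictDegree {k : Type*} [Field k] {s J J' : ℕ} {p q : MvPolynomial (Fin s) k}
    (hp : p ∈ restrictDegree (Fin s) k J) (hq : q ∈ restrictDegree (Fin s) k J') :
    p * q ∈ restrictDegree (Fin s) k (J + J') := by
  classical
  rw [mem_restrictDegree] at *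
  intro α hα i
  obtain ⟨β, hβ, γ, hγ, rfl⟩ := Finset.mem_add.1 (support_mul p q hα)
  exact Nat.add_le_add (hp β hβ i) (hq γ hγ i)

theorem restrictDegree_mono {k : Type*} [Field k] {s J J' : ℕ} (h : J ≤ J') :
    restrictDegree (Fin s) k J ≤ restrictDegree (Fin s) k J' := by
  intro p hp
  rw [mem_restrictDegree] at *
  exact fun α hα i => (hp α hα i).trans h

theorem exists_mem_restrictDegree {k : Type*} [Field k] {s : ℕ} (p : MvPolynomial (Fin s) k) :
    ∃ J, p ∈ restrictDegree (Fin s) k J :=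
  ⟨p.totalDegree, restrictTotalDegree_le_restrictDegree _ _ p.totalDegree
    ((mem_restrictTotalDegree _ _ _).2 le_rfl)⟩

variable {k : Type*} [Field k] {n : ℕ} {M : Type*} [AddCommGroup M] [Module k M]
  [Module (MvPolynomial (Fin n) k) M] [IsScalarTower k (MvPolynomial (Fin n) k) M]
  {ℳ : ℤ → Submodule k M}

/-- The normalization is not assumed homogeneous, so only the filtration by degree is controlled. -/
theorem smul_mem_gradedLE (hℳ : IsGradedPolyModule (n := n) ℳ) {f : MvPolynomial (Fin n) k}
    {D : ℕ} (hf : f.totalDegree ≤ D) {b : ℤ} {m : M} (hm : m ∈ gradedLE ℳ b) :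
    f • m ∈ gradedLE ℳ (D + b) := by
  rw [← sum_homogeneousComponent f, Finset.sum_smul]
  refine Submodule.sum_mem _ fun i hi => ?_
  rw [Finset.mem_range] at hi
  have hle : gradedLE ℳ b ≤ (gradedLE ℳ (D + b)).comap
      ((LinearMap.lsmul (MvPolynomial (Fin n) k) M (homogeneousComponent i f)).restrictScalars k) :=
    iSup₂_le fun j hj m hm => le_gradedLE (i := i + j) (by omega)
      (hℳ.smul_mem i j _ m (homogeneousComponent_isHomogeneous i f) hm)
  exact hle hm

/-- The `k`-linear map `p ↦ φ p • m`. -/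
noncomputable def orbitMap {s : ℕ} (φ : MvPolynomial (Fin s) k →ₐ[k] MvPolynomial (Fin n) k)
    (m : M) : MvPolynomial (Fin s) k →ₗ[k] M :=
  ((LinearMap.toSpanSingleton (MvPolynomial (Fin n) k) M m).restrictScalars k) ∘ₗ φ.toLinearMap

/-- Otherwise every generator is killed by some nonzero polynomial, and the product of these,
nonzero in a domain, kills `M`. -/
theorem exists_orbitMap_injective [Module.Finite (MvPolynomial (Fin n) k) M] {s : ℕ}
    {φ : MvPolynomial (Fin s) k →ₐ[k] MvPolynomial (Fin n) k}
    (hφ : ∀ p, φ p ∈ Module.annihilator (MvPolynomial (Fin n) k) M → p = 0) :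
    ∃ m : M, Function.Injective (orbitMap φ m) := by
  obtain ⟨T, hT⟩ := Module.Finite.fg_top (R := MvPolynomial (Fin n) k) (M := M)
  by_contra! hno
  have h1 : ∀ m : M, ∃ p, p ≠ 0 ∧ φ p • m = 0 := by
    intro m
    have := hno m
    rw [injective_iff_map_eq_zero] at this
    push Not at this
    obtain ⟨p, h0, hp⟩ := this
    exact ⟨p, hp, h0⟩
  choose p hp0 hp using h1
  have h2 : φ (∏ t ∈ T, p t) ∈ Module.annihilator (MvPolynomial (Fin n) k) M := by
    rw [← Submodule.annihilator_top, ← hT, Submodule.mem_annihilator_span]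
    rintro ⟨t, ht⟩
    obtain ⟨q, hq⟩ := Finset.dvd_prod_of_mem p ht
    rw [hq, mul_comm, map_mul, mul_smul, hp, smul_zero]
  exact Finset.prod_ne_zero_iff.2 (fun t _ => hp0 t) (hφ _ h2)

theorem exists_pow_le_hilbertSum [Module.Finite (MvPolynomial (Fin n) k) M]
    (hℳ : IsGradedPolyModule (n := n) ℳ) {s : ℕ}
    {φ : MvPolynomial (Fin s) k →ₐ[k] MvPolynomial (Fin n) k}
    (hφ : ∀ p, φ p ∈ Module.annihilator (MvPolynomial (Fin n) k) M → p = 0) :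
    ∃ c : ℕ, 0 < c ∧ ∀ j : ℕ, 1 ≤ j → (j : ℤ) ^ s ≤ (hilbertSum ℳ (c * j) : ℤ) := by
  obtain ⟨m, hm⟩ := exists_orbitMap_injective hφ
  obtain ⟨b, hb⟩ := exists_mem_gradedLE hℳ.isInternal m
  obtain ⟨a, ha⟩ := exists_forall_eq_bot hℳ
  have hfin := finiteDimensional_of_isGradedPolyModule hℳ
  let h : Fin s → MvPolynomial (Fin n) k := fun i => φ (X i)
  have hφh : φ = aeval h := by
    ext i
    simp [h]
  let c₀ := ∑ i, (h i).totalDegree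
  -- `c₀ * j` bounds the degree of `φ p`, `b.toNat` the degree of `m` (absorbed since `j ≥ 1`), and
  -- the final `1` makes the constant positive.
  refine ⟨c₀ + b.toNat + 1, by omega, fun j hj => ?_⟩
  have hle : (restrictDegree (Fin s) k j).map (orbitMap φ m) ≤
      gradedLE ℳ ((c₀ + b.toNat + 1 : ℕ) * j) := by
    rintro _ ⟨p, hp, rfl⟩
    have h1 : (φ p).totalDegree ≤ c₀ * j := hφh ▸ totalDegree_aeval_le h hp
    refine gradedLE_mono ?_ (smul_mem_gradedLE hℳ h1 hb)
    have h2 : b ≤ b.toNat := Int.self_le_toNat b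
    have h3 : (b.toNat : ℤ) * 1 ≤ b.toNat * j := by gcongr; exact_mod_cast hj
    push_cast
    nlinarith
  have := finiteDimensional_gradedLE ha hfin ((c₀ + b.toNat + 1 : ℕ) * j)
  have h1 := Submodule.finrank_mono hle
  rw [finrank_gradedLE hℳ.isInternal ha hfin, 
    ← LinearEquiv.finrank_eq (Submodule.equivMapOfInjective _ hm (restrictDegree (Fin s) k j)),
    finrank_restrictDegree] at h1
  have h2 : j ^ s ≤ (j + 1) ^ s := Nat.pow_le_pow_left (by omega) s
  exact_mod_cast h2.trans h1

/-- The sum of the images of the polynomials with all exponents at most `J`. -/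
noncomputable def boxSpan {s : ℕ} (φ : MvPolynomial (Fin s) k →ₐ[k] MvPolynomial (Fin n) k)
    (G : Finset M) (J : ℕ) : Submodule k M :=
  G.sup fun g => (restrictDegree (Fin s) k J).map (orbitMap φ g)

theorem boxSpan_mono {s : ℕ} (φ : MvPolynomial (Fin s) k →ₐ[k] MvPolynomial (Fin n) k)
    (G : Finset M) {J J' : ℕ} (h : J ≤ J') : boxSpan φ G J ≤ boxSpan φ G J' :=
  Finset.sup_mono_fun fun _ _ => Submodule.map_mono (restrictDegree_mono h)

theorem smul_mem_boxSpan {s : ℕ} {φ : MvPolynomial (Fin s) k →ₐ[k] MvPolynomial (Fin n) k}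
    {G : Finset M} {g : M} (hg : g ∈ G) {J : ℕ} {p : MvPolynomial (Fin s) k}
    (hp : p ∈ restrictDegree (Fin s) k J) : φ p • g ∈ boxSpan φ G J :=
  (Finset.le_sup (f := fun g => (restrictDegree (Fin s) k J).map (orbitMap φ g)) hg) ⟨p, hp, rfl⟩

theorem finrank_boxSpan_le {s : ℕ} (φ : MvPolynomial (Fin s) k →ₐ[k] MvPolynomial (Fin n) k)
    (G : Finset M) (J : ℕ) : finrank k (boxSpan φ G J) ≤ G.card * (J + 1) ^ s := by
  refine (finrank_finset_sup_le _ _ fun _ => inferInstance).trans ?_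
  refine (Finset.sum_le_card_nsmul _ _ ((J + 1) ^ s) fun g _ => ?_).trans (by simp)
  rw [← finrank_restrictDegree k]
  exact Submodule.finrank_map_le _ _

/-- `M` is finite over the normalizing polynomial ring: products of the generators of `S / ann M`
with those of `M` suffice. -/
theorem exists_boxSpan_eq_top [Module.Finite (MvPolynomial (Fin n) k) M] {s : ℕ}
    {φ : MvPolynomial (Fin s) k →ₐ[k] MvPolynomial (Fin n) k} {F : Finset (MvPolynomial (Fin n) k)}
    (hF : ∀ f, ∃ a : MvPolynomial (Fin n) k → MvPolynomial (Fin s) k,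
      f - ∑ r ∈ F, φ (a r) * r ∈ Module.annihilator (MvPolynomial (Fin n) k) M) :
    ∃ G : Finset M, ∀ m : M, ∃ J, m ∈ boxSpan φ G J := by
  classical
  obtain ⟨T, hT⟩ := Module.Finite.fg_top (R := MvPolynomial (Fin n) k) (M := M)
  refine ⟨Finset.image₂ (fun r t => r • t) F T, fun m => ?_⟩
  have hm : m ∈ Submodule.span (MvPolynomial (Fin n) k) (T : Set M) := hT ▸ Submodule.mem_top
  obtain ⟨f, -, rfl⟩ := Submodule.mem_span_finset.1 hm
  choose a ha using hF
  choose J hJ using exists_mem_restrictDegree (k := k) (s := s)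
  obtain ⟨B, hB⟩ := (Finset.image₂ (fun r t => J (a (f t) r)) F T).exists_le
  refine ⟨B, Submodule.sum_mem _ fun t ht => ?_⟩
  have h1 := Module.mem_annihilator.1 (ha (f t)) t
  rw [sub_smul, sub_eq_zero] at h1
  rw [h1, Finset.sum_smul]
  refine Submodule.sum_mem _ fun r hr => ?_
  rw [mul_smul]
  exact smul_mem_boxSpan (Finset.mem_image₂_of_mem hr ht)
    (restrictDegree_mono (hB _ (Finset.mem_image₂_of_mem hr ht)) (hJ _))

/-- A uniform `c` exists because only the finitely many `X i • g` need expanding; `φ p` commutes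
with `X i`, and exponents add under multiplication. -/
theorem exists_X_smul_mem_boxSpan {s : ℕ}
    {φ : MvPolynomial (Fin s) k →ₐ[k] MvPolynomial (Fin n) k} {G : Finset M}
    (hG : ∀ m : M, ∃ J, m ∈ boxSpan φ G J) :
    ∃ c : ℕ, ∀ (i : Fin n) (J : ℕ), ∀ m ∈ boxSpan φ G J,
      (X i : MvPolynomial (Fin n) k) • m ∈ boxSpan φ G (J + c) := by
  classical
  choose B hB using hG
  obtain ⟨c, hc⟩ := (Finset.image₂ (fun (i : Fin n) g => B ((X i : MvPolynomial (Fin n) k) • g))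
    Finset.univ G).exists_le
  have hmul : ∀ {J J' : ℕ} {p : MvPolynomial (Fin s) k}, p ∈ restrictDegree (Fin s) k J →
      ∀ m ∈ boxSpan φ G J', φ p • m ∈ boxSpan φ G (J + J') := by
    intro J J' p hp m hm
    have hle : boxSpan φ G J' ≤ (boxSpan φ G (J + J')).comap
        ((LinearMap.lsmul (MvPolynomial (Fin n) k) M (φ p)).restrictScalars k) := by
      refine Finset.sup_le fun g hg => ?_
      rintro _ ⟨q, hq, rfl⟩
      change φ p • φ q • g ∈ boxSpan φ G (J + J')
      rw [← mul_smul, ← map_mul]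
      exact smul_mem_boxSpan hg (mul_mem_restrictDegree hp hq)
    exact hle hm
  refine ⟨c, fun i J m hm => ?_⟩
  have hle : boxSpan φ G J ≤ (boxSpan φ G (J + c)).comap
      ((LinearMap.lsmul (MvPolynomial (Fin n) k) M (X i)).restrictScalars k) := by
    refine Finset.sup_le fun g hg => ?_
    rintro _ ⟨p, hp, rfl⟩
    change (X i : MvPolynomial (Fin n) k) • φ p • g ∈ boxSpan φ G (J + c)
    rw [smul_comm]
    exact hmul hp _ (boxSpan_mono φ G
      (hc _ (Finset.mem_image₂_of_mem (Finset.mem_univ i) hg)) (hB _))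
  exact hle hm

theorem monomial_smul_mem_boxSpan {s c : ℕ}
    {φ : MvPolynomial (Fin s) k →ₐ[k] MvPolynomial (Fin n) k} {G : Finset M}
    (hc : ∀ (i : Fin n) (J : ℕ), ∀ m ∈ boxSpan φ G J,
      (X i : MvPolynomial (Fin n) k) • m ∈ boxSpan φ G (J + c))
    (α : Fin n →₀ ℕ) {J : ℕ} {m : M} (hm : m ∈ boxSpan φ G J) :
    monomial α (1 : k) • m ∈ boxSpan φ G (J + c * α.degree) := by
  induction hd : α.degree generalizing α with
  | zero =>
    rw [Finsupp.degree_eq_zero_iff] at hd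
    subst hd
    simpa using hm
  | succ d ih =>
    have hα : α ≠ 0 := by
      rintro rfl
      simp at hd
    obtain ⟨i, hi⟩ := Finsupp.ne_iff.1 hα
    have hα' : α = Finsupp.single i 1 + (α - Finsupp.single i 1) := by
      rw [add_tsub_cancel_of_le]
      exact Finsupp.single_le_iff.2 (Nat.one_le_iff_ne_zero.2 hi)
    have h1 : monomial α (1 : k) = X i * monomial (α - Finsupp.single i 1) 1 := by
      conv_lhs => rw [hα']
      rw [X, monomial_mul, one_mul]
    have h2 : (α - Finsupp.single i 1).degree = d := by
      have := congrArg Finsupp.degree hα'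
      rw [map_add, Finsupp.degree_single] at this
      omega
    rw [h1, mul_smul, mul_add, mul_one, ← add_assoc]
    exact hc i _ _ (ih _ h2)

/-- Elements of degree at most `j` lie in a box whose side is linear in `j`, and a box of side `J`
has dimension `O(J ^ s)`. -/
theorem hilbertSum_isBigO [Module.Finite (MvPolynomial (Fin n) k) M]
    (hℳ : IsGradedPolyModule (n := n) ℳ) {s : ℕ}
    {φ : MvPolynomial (Fin s) k →ₐ[k] MvPolynomial (Fin n) k} {F : Finset (MvPolynomial (Fin n) k)}
    (hF : ∀ f, ∃ a : MvPolynomial (Fin n) k → MvPolynomial (Fin s) k,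
      f - ∑ r ∈ F, φ (a r) * r ∈ Module.annihilator (MvPolynomial (Fin n) k) M) :
    (fun j => ((hilbertSum ℳ j : ℤ) : ℝ)) =O[atTop] fun j : ℤ => (j : ℝ) ^ s := by
  classical
  obtain ⟨G, hG⟩ := exists_boxSpan_eq_top hF
  obtain ⟨c, hc⟩ := exists_X_smul_mem_boxSpan hG
  obtain ⟨T, a, hT⟩ := exists_le_span_monomial_smul hℳ
  obtain ⟨a', ha'⟩ := exists_forall_eq_bot hℳ
  have hfin := finiteDimensional_of_isGradedPolyModule hℳ
  choose B hB using hG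
  obtain ⟨b, hb⟩ := (T.image B).exists_le
  have hle : ∀ j : ℤ, gradedLE ℳ j ≤ boxSpan φ G (b + c * (j - a).toNat) := by
    refine fun j => iSup₂_le fun i hi => (hT i).trans (Submodule.span_le.2 ?_)
    rintro _ ⟨t, ht, α, hα, rfl⟩
    have h1 : t ∈ boxSpan φ G b := boxSpan_mono φ G (hb _ (Finset.mem_image_of_mem B ht)) (hB t)
    refine boxSpan_mono φ G ?_ (monomial_smul_mem_boxSpan hc α h1)
    have : α.degree ≤ (j - a).toNat := by omega
    gcongr
  have hbound : ∀ j : ℤ, hilbertSum ℳ j ≤ G.card * (b + c * (j - a).toNat + 1) ^ s := by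
    intro j
    have : FiniteDimensional k (boxSpan φ G (b + c * (j - a).toNat)) := by
      unfold boxSpan
      infer_instance
    rw [← finrank_gradedLE hℳ.isInternal ha' hfin]
    exact (Submodule.finrank_mono (hle j)).trans (finrank_boxSpan_le φ G _)
  -- For `j ≥ 1`, the number `C * j` dominates the side of the box, the shift by `a` included.
  let C : ℕ := b + c * (1 + a.natAbs) + 1
  refine Asymptotics.IsBigO.of_bound (G.card * (C : ℝ) ^ s) ?_
  filter_upwards [eventually_ge_atTop 1] with j hj
  lift j to ℕ using by omega
  have hj : 1 ≤ j := by exact_mod_cast hj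
  have h1 : b + c * ((j : ℤ) - a).toNat + 1 ≤ C * j := by
    have h2 : ((j : ℤ) - a).toNat ≤ (1 + a.natAbs) * j := by
      have : ((j : ℤ) - a).toNat ≤ j + a.natAbs := by omega
      nlinarith [Nat.zero_le a.natAbs]
    calc b + c * ((j : ℤ) - a).toNat + 1 ≤ b * j + c * ((1 + a.natAbs) * j) + 1 * j := by
          gcongr
          · exact Nat.le_mul_of_pos_right b hj
          · omega
      _ = C * j := by ring
  have h3 : hilbertSum ℳ j ≤ G.card * (C * j) ^ s :=
    (hbound j).trans (Nat.mul_le_mul_left _ (Nat.pow_le_pow_left h1 s))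
  have h4 : (hilbertSum ℳ j : ℝ) ≤ G.card * (C * j) ^ s := by exact_mod_cast h3
  simp only [Int.cast_natCast, norm_pow, Real.norm_natCast]
  rwa [mul_assoc, ← mul_pow]

end Growth

/-! ### Multiplicities, depth and the conclusion. -/

section Main

open Module Filter

variable {k : Type*} [Field k] {n : ℕ} {M : Type*} [AddCommGroup M] [Module k M]
  [Module (MvPolynomial (Fin n) k) M] [IsScalarTower k (MvPolynomial (Fin n) k) M]
  {ℳ : ℤ → Submodule k M}

/-- The cumulative Hilbert function of a finitely generated graded module of dimension `d` is
eventually a polynomial of degree `d`. -/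
theorem exists_pos_fwdDiff_iter_hilbertSum [Module.Finite (MvPolynomial (Fin n) k) M]
    (hℳ : IsGradedPolyModule (n := n) ℳ) {d : ℕ}
    (hdim : supportDim (MvPolynomial (Fin n) k) M = (d : WithBot ℕ∞)) :
    ∃ e : ℤ, 0 < e ∧ (fwdDiff 1)^[d] (fun j => (hilbertSum ℳ j : ℤ)) =ᶠ[atTop] fun _ => e := by
  have hM : Nontrivial M := by
    rw [← supportDim_ne_bot_iff_nontrivial (MvPolynomial (Fin n) k), hdim]
    exact WithBot.natCast_ne_bot d
  have hI : Module.annihilator (MvPolynomial (Fin n) k) M ≠ ⊤ := by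
    rw [Ne, Module.annihilator_eq_top_iff]
    exact not_subsingleton M
  obtain ⟨s, φ, hs, hφ, F, hF⟩ := exists_noether_normalization _ hI
  rw [← supportDim_eq_ringKrullDim_quotient_annihilator, hdim] at hs
  obtain rfl : d = s := by exact_mod_cast hs
  obtain ⟨c, hc, hlower⟩ := exists_pow_le_hilbertSum hℳ hφ
  exact exists_pos_fwdDiff_iter_eventuallyEq hc
    (fwdDiff_iter_hilbertSum_of_X_smul_eq_zero n hℳ fun i _ hi => absurd i.2 (by omega))
    (hilbertSum_isBigO hℳ hF) hlower

theorem fwdDiff_iter_hilbertSum_eventuallyEq_gradedE [Module.Finite (MvPolynomial (Fin n) k) M]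
    (hℳ : IsGradedPolyModule (n := n) ℳ) {d : ℕ}
    (hdim : supportDim (MvPolynomial (Fin n) k) M = (d : WithBot ℕ∞)) :
    (fwdDiff 1)^[d] (fun j => (hilbertSum ℳ j : ℤ)) =ᶠ[atTop] fun _ => gradedE n ℳ d := by
  obtain ⟨e, he, h⟩ := exists_pos_fwdDiff_iter_hilbertSum hℳ hdim
  have hasy : HasHilbertAsymptotics ℳ d e := by
    have h1 := isBigO_sub_of_fwdDiff_iter_eventuallyEq h
    simp only [Int.cast_natCast] at h1
    exact h1
  have hex : supportDim (MvPolynomial (Fin n) k) M = (d : WithBot ℕ∞) ∧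
      ∃ e : ℤ, 0 < e ∧ HasHilbertAsymptotics ℳ d e := ⟨hdim, e, he, hasy⟩
  have : gradedE n ℳ d = e := by
    rw [gradedE, dif_pos hex]
    -- The multiplicity is a chosen witness, identified by uniqueness of the leading coefficient.
    exact hex.2.choose_spec.2.unique hasy
  rwa [this]

/-- The ideal of polynomials without constant term, as a point of the spectrum. -/
noncomputable def irrelevantPrime (k : Type*) [Field k] (n : ℕ) :
    PrimeSpectrum (MvPolynomial (Fin n) k) :=
  ⟨RingHom.ker (constantCoeff : MvPolynomial (Fin n) k →+* k), RingHom.ker_isPrime _⟩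

theorem span_range_X_le_irrelevantPrime :
    Ideal.span (Set.range (X : Fin n → MvPolynomial (Fin n) k)) ≤
      (irrelevantPrime k n).asIdeal := by
  rw [Ideal.span_le]
  rintro _ ⟨i, rfl⟩
  exact constantCoeff_X k i

theorem mem_span_range_X_of_isHomogeneous {ℓ : MvPolynomial (Fin n) k} (hℓ : ℓ.IsHomogeneous 1) :
    ℓ ∈ Ideal.span (Set.range (X : Fin n → MvPolynomial (Fin n) k)) := by
  rw [← Set.image_univ, mem_ideal_span_X_image]
  intro α hα
  by_contra! h
  have hα0 : α = 0 := Finsupp.ext fun i => h i trivial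
  have := hℓ (mem_support_iff.1 hα)
  rw [hα0] at this
  simp at this

/-- Nonconstant monomials raise the degree, so only the constant term survives in degree `j`. -/
theorem gradedProj_smul_of_mem (hℳ : IsGradedPolyModule (n := n) ℳ) {j : ℤ} {m : M}
    (hm : m ∈ ℳ j) (f : MvPolynomial (Fin n) k) :
    gradedProj hℳ.isInternal j (f • m) = constantCoeff f • m := by
  induction f using MvPolynomial.induction_on' with
  | monomial α c =>
    by_cases hα : α = 0
    · subst hα
      rw [monomial_zero', constantCoeff_C, ← algebraMap_eq, algebraMap_smul, map_smul,
        gradedProj_of_mem _ hm]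
    · have hdeg : α.degree ≠ 0 := fun h => hα ((Finsupp.degree_eq_zero_iff α).1 h)
      rw [gradedProj_of_mem_ne _ (i := α.degree + j) (by omega)
        (hℳ.smul_mem _ j _ m (isHomogeneous_monomial c rfl) hm), constantCoeff_monomial,
        if_neg hα, zero_smul]
  | add p q hp hq => rw [add_smul, map_add, hp, hq, map_add, add_smul]

/-- A nonzero homogeneous element is not killed by any polynomial with nonzero constant term. -/
theorem irrelevantPrime_mem_support (hℳ : IsGradedPolyModule (n := n) ℳ) [Nontrivial M] :
    irrelevantPrime k n ∈ support (MvPolynomial (Fin n) k) M := by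
  obtain ⟨m, hm⟩ := exists_ne (0 : M)
  have : ∃ j, gradedProj hℳ.isInternal j m ≠ 0 := by
    by_contra! h
    exact hm (gradedProj_eq_zero_imp hℳ.isInternal h)
  obtain ⟨j, hj⟩ := this
  rw [mem_support_iff']
  refine ⟨gradedProj hℳ.isInternal j m, fun f hf h0 => ?_⟩
  have h1 := gradedProj_smul_of_mem hℳ (gradedProj_mem hℳ.isInternal j m) f
  rw [h0, map_zero, eq_comm, smul_eq_zero] at h1
  exact h1.elim hf hj

theorem gradedDepth_le_supportDim [Module.Finite (MvPolynomial (Fin n) k) M]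
    (hℳ : IsGradedPolyModule (n := n) ℳ) {d : ℕ}
    (hdim : supportDim (MvPolynomial (Fin n) k) M = (d : WithBot ℕ∞)) :
    gradedDepth k n M ≤ d := by
  have hM : Nontrivial M := by
    rw [← supportDim_ne_bot_iff_nontrivial (MvPolynomial (Fin n) k), hdim]
    exact WithBot.natCast_ne_bot d
  have e : (⊤ : Submodule (MvPolynomial (Fin n) k) M) ≃ₗ[MvPolynomial (Fin n) k] M :=
    Submodule.topEquiv
  refine iSup₂_le fun rs hrs => ?_
  have h := length_le_supportDim_of_mem_support (irrelevantPrime k n) rs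
    (fun r hr => span_range_X_le_irrelevantPrime (hrs.2 r hr)) (⊤ : Submodule _ M)
    hrs.1.toIsWeaklyRegular (e.support_eq ▸ irrelevantPrime_mem_support hℳ)
  rw [supportDim_eq_of_equiv e, hdim] at h
  exact_mod_cast h

omit [Module k M] [IsScalarTower k (MvPolynomial (Fin n) k) M] in
theorem exists_isRegular_of_le_gradedDepth [Nontrivial M] {t : ℕ}
    (h : (t : ℕ∞) ≤ gradedDepth k n M) :
    ∃ rs : List (MvPolynomial (Fin n) k), RingTheory.Sequence.IsRegular M rs ∧
      (∀ r ∈ rs, r ∈ Ideal.span (Set.range (X : Fin n → MvPolynomial (Fin n) k))) ∧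
      t ≤ rs.length := by
  -- A strict bound below a supremum yields a member without assuming that it is attained; `t = 0`
  -- has no predecessor, and the empty sequence serves.
  rcases t with _ | t
  · exact ⟨[], RingTheory.Sequence.IsRegular.nil _ M, by simp, by simp⟩
  · have hlt : (t : ℕ∞) < gradedDepth k n M :=
      lt_of_lt_of_le (by exact_mod_cast Nat.lt_succ_self t) h
    rw [gradedDepth] at hlt
    simp only [lt_iSup_iff] at hlt
    obtain ⟨rs, hrs, hlt⟩ := hlt
    exact ⟨rs, hrs.1, hrs.2, by exact_mod_cast hlt⟩

end Main

open Module Filter in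
theorem mainTheorem3 {k : Type*} [Field k] {n : ℕ} {M : Type*} [AddCommGroup M]
    [Module k M] [Module (MvPolynomial (Fin n) k) M]
    [IsScalarTower k (MvPolynomial (Fin n) k) M]
    [Module.Finite (MvPolynomial (Fin n) k) M]
    (ℳ : ℤ → Submodule k M) (hℳ : IsGradedPolyModule (n := n) ℳ)
    (d : ℕ) (hd : 0 < d)
    (hdim : Module.supportDim (MvPolynomial (Fin n) k) M = (d : WithBot ℕ∞))
    (ℓ : MvPolynomial (Fin n) k) (hℓ : ℓ.IsHomogeneous 1)
    (hCM : IsGradedCM k n (QuotSMulTop ℓ M))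
    (hdimq : Module.supportDim (MvPolynomial (Fin n) k) (QuotSMulTop ℓ M) =
      ((d - 1 : ℕ) : WithBot ℕ∞))
    (he : gradedE n (quotGrading ℳ ℓ) (d - 1) = gradedE n ℳ d) :
    IsSMulRegular M ℓ ∧ IsGradedCM k n M := by
  obtain ⟨t, rfl⟩ : ∃ t, d = t + 1 := ⟨d - 1, by omega⟩
  rw [Nat.add_sub_cancel] at hdimq he
  have hM : Nontrivial M := by
    rw [← supportDim_ne_bot_iff_nontrivial (MvPolynomial (Fin n) k), hdim]
    exact WithBot.natCast_ne_bot _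
  have hℓX := mem_span_range_X_of_isHomogeneous hℓ
  have := hCM.1
  have hdepth := hCM.2
  rw [hdimq] at hdepth
  obtain ⟨rs, hreg, hrs, hlen⟩ := exists_isRegular_of_le_gradedDepth (M := QuotSMulTop ℓ M)
    (t := t) (by exact_mod_cast hdepth.ge)
  have hK := isGradedPolyModule_torsionGrading hℳ hℓ
  -- Both multiplicities are `t`-th differences in the exact sequence and cancel by `he`; the shift
  -- by one is harmless eventually.
  have hKzero : (fwdDiff 1)^[t] (fun j => (hilbertSum (torsionGrading ℳ ℓ) j : ℤ))
      =ᶠ[atTop] fun _ => 0 := by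
    have h1 := fwdDiff_iter_hilbertSum_eventuallyEq_gradedE hℳ hdim
    have h2 := fwdDiff_iter_hilbertSum_eventuallyEq_gradedE (isGradedPolyModule_quotGrading hℳ hℓ) hdimq
    rw [Function.iterate_succ_apply, fwdDiff_hilbertSum hℳ hℓ, fwdDiff_iter_add,
      fwdDiff_iter_const_smul] at h1
    filter_upwards [h1, eventually_add_one h2] with j h1 h2
    have h3 := fwdDiff_iter_comp_add (1 : ℤ)
      (fun j => (hilbertSum (quotGrading ℳ ℓ) j : ℤ)) 1 t j
    rw [Pi.add_apply, h3, h2, he, Pi.smul_apply, smul_eq_mul] at h1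
    omega
  have hsub : Subsingleton (Submodule.torsionBy (MvPolynomial (Fin n) k) M ℓ) := by
    by_contra hne
    rw [not_subsingleton_iff_nontrivial] at hne
    have hlow := length_le_supportDim_torsionBy (M := M) (irrelevantPrime k n)
      (span_range_X_le_irrelevantPrime hℓX) rs
      (fun r hr => span_range_X_le_irrelevantPrime (hrs r hr)) hreg.toIsWeaklyRegular
      (irrelevantPrime_mem_support hK)
    have hup := supportDim_le_of_injective
      (Submodule.torsionBy (MvPolynomial (Fin n) k) M ℓ).subtype (Submodule.injective_subtype _)
    rw [hdim] at hup
    -- The lower bound excludes dimension `⊥` and the upper bound excludes `⊤`.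
    obtain ⟨r, hr⟩ : ∃ r : ℕ, supportDim (MvPolynomial (Fin n) k)
        (Submodule.torsionBy (MvPolynomial (Fin n) k) M ℓ) = (r : WithBot ℕ∞) := by
      generalize supportDim (MvPolynomial (Fin n) k)
        (Submodule.torsionBy (MvPolynomial (Fin n) k) M ℓ) = D at hlow hup
      induction D with
      | bot => simp at hlow
      | coe D =>
        have hD : D ≤ (t + 1 : ℕ) := by exact_mod_cast hup
        lift D to ℕ using ne_top_of_le_ne_top (ENat.natCast_ne_top _) hD
        exact ⟨D, rfl⟩
    rw [hr] at hlow
    have htr : t ≤ r := hlen.trans (by exact_mod_cast hlow)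
    -- As `t ≤ r`, the `r`-th difference of `H_K` would be both eventually zero and eventually
    -- positive.
    obtain ⟨e, he0, he⟩ := exists_pos_fwdDiff_iter_hilbertSum hK hr
    obtain ⟨j, h1, h2⟩ := (he.and (fwdDiff_iter_eventuallyEq_zero_of_le htr hKzero)).exists
    exact he0.ne' (h1.symm.trans h2)
  have hregular : IsSMulRegular M ℓ := by
    intro x y hxy
    have hxy : ℓ • x = ℓ • y := hxy
    have hmem : x - y ∈ Submodule.torsionBy (MvPolynomial (Fin n) k) M ℓ := by
      rw [Submodule.mem_torsionBy_iff, smul_sub, hxy, sub_self]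
    exact sub_eq_zero.1 (congrArg Subtype.val (Subsingleton.elim (⟨x - y, hmem⟩ :
      Submodule.torsionBy (MvPolynomial (Fin n) k) M ℓ) 0))
  refine ⟨hregular, hM, ?_⟩
  rw [hdim]
  have hle := gradedDepth_le_supportDim hℳ hdim
  have hge : ((t + 1 : ℕ) : ℕ∞) ≤ gradedDepth k n M := by
    have hcons : RingTheory.Sequence.IsRegular M (ℓ :: rs) ∧
        ∀ r ∈ ℓ :: rs, r ∈ Ideal.span (Set.range (X : Fin n → MvPolynomial (Fin n) k)) := by
      refine ⟨(RingTheory.Sequence.isRegular_cons_iff M ℓ rs).2 ⟨hregular, hreg⟩, ?_⟩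
      rintro r (_ | ⟨_, hr⟩)
      · exact hℓX
      · exact hrs r hr
    refine le_trans ?_ (le_iSup₂ (f := fun (rs : List (MvPolynomial (Fin n) k))
      (_ : RingTheory.Sequence.IsRegular M rs ∧
        ∀ r ∈ rs, r ∈ Ideal.span (Set.range (X : Fin n → MvPolynomial (Fin n) k))) =>
      (rs.length : ℕ∞)) (ℓ :: rs) hcons)
    rw [List.length_cons]
    exact_mod_cast Nat.succ_le_succ hlen
  exact_mod_cast le_antisymm hle hge
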